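/- Let $k\ge 0$ be an integer, and let $NC(k)$ be the set of noncrossing partitions of $k$ ordered points, which is the set of partitions associated with the free quantum permutation group $S_n^+$. Write $|\pi|$ for the number of blocks of a partition $\pi$, and $\pi\vee\sigma$ for the join of $\pi$ and $\sigma$ in the lattice of all partitions of the $k$ points. Let $G_{kn}$ be the Gram matrix indexed by $\pi,\sigma\in NC(k)$, with entries $G_{kn}(\pi,\sigma)=n^{|\pi\vee\sigma|}$. Let $P_r$ be the Chebyshev polynomials given by $P_0(x)=1$, $P_1(x)=x$, $P_{r+1}(x)=xP_r(x)-P_{r-1}(x)$, and put $$a_k=\sum_{\pi\in NC(k)}(2|\pi|-k),\qquad f_{kr}=\binom{2k}{k-r}-\binom{2k}{k-r-1},\qquad d_{kr}=f_{kr}-f_{k,r+1},$$ where a binomial coefficient with negative lower entry is $0$. Then $$\det(G_{kn})=(\sqrt n)^{a_k}\prod_{r=1}^kP_r(\sqrt n)^{d_{kr}}$$ as an identity of rational functions in the indeterminate $\sqrt n$. The same identity holds between real numbers for every real $n\ge 0$ such that $P_r(\sqrt n)\ne 0$ for all $1\le r\le k$ with $d_{kr}<0$. -/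

import Mathlib

/-- A partition of the `k` ordered points `0 < 1 < ... < k - 1`, viewed as an equivalence relation,
is noncrossing if there are no `a < b < c < d` with `a, c` in one block and `b, d` in a different
block. -/
def IsNoncrossing {k : ℕ} (π : Setoid (Fin k)) : Prop :=
  ∀ a b c d : Fin k, a < b → b < c → c < d → π a c → π b d → π a b

/-- The set of noncrossing partitions of `k` points. -/
abbrev NCPartition (k : ℕ) : Type := {π : Setoid (Fin k) // IsNoncrossing π}

noncomputable instance NCPartition.instFintype (k : ℕ) : Fintype (NCPartition k) :=
  haveI : Finite (Setoid (Fin k)) :=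
    Finite.of_injective (fun π : Setoid (Fin k) => (fun a b => π a b : Fin k → Fin k → Prop))
      (fun _ _ h => Setoid.ext fun a b => iff_of_eq (congrFun (congrFun h a) b))
  Fintype.ofFinite _

noncomputable instance NCPartition.instDecidableEq (k : ℕ) : DecidableEq (NCPartition k) :=
  Classical.decEq _

/-- The number of blocks of a partition. -/
noncomputable def blockCount {k : ℕ} (π : Setoid (Fin k)) : ℕ := Nat.card (Quotient π)

/-- The Gram matrix, with entries `n ^ |π ∨ σ|` indexed by noncrossing partitions. The join is the
one of the lattice of all partitions (so it need not be noncrossing). -/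
noncomputable def gramMatrix {R : Type*} [CommRing R] (k : ℕ) (n : R) :
    Matrix (NCPartition k) (NCPartition k) R :=
  Matrix.of fun π σ => n ^ blockCount (π.1 ⊔ σ.1)

/-- The integer `a_k`, the sum of `2|π| - k` over all noncrossing partitions `π` of `k` points. -/
noncomputable def gramExponent (k : ℕ) : ℤ :=
  ∑ π : NCPartition k, (2 * (blockCount π.1 : ℤ) - (k : ℤ))

/-- The binomial coefficient with an arbitrary integer as lower entry (zero if this is negative). -/
def intBinom (m : ℕ) (j : ℤ) : ℤ := if 0 ≤ j then (m.choose j.toNat : ℤ) else 0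

/-- `f_{k,r} = binom(2k, k - r) - binom(2k, k - r - 1)`. -/
def fCoeff (k : ℕ) (r : ℤ) : ℤ :=
  intBinom (2 * k) ((k : ℤ) - r) - intBinom (2 * k) ((k : ℤ) - r - 1)

/-- `d_{k,r} = f_{k,r} - f_{k,r+1}`. -/
def dExponent (k : ℕ) (r : ℤ) : ℤ := fCoeff k r - fCoeff k (r + 1)

/-! ### Dyck words -/

/-- `BallotFrom h w`: the lattice path with steps `w` (`true` is up, `false` is down) that starts at
height `h` stays nonnegative and ends at height `0`. -/
def BallotFrom : ℕ → List Bool → Prop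
  | h, [] => h = 0
  | h, true :: w => BallotFrom (h + 1) w
  | 0, false :: _ => False
  | h + 1, false :: w => BallotFrom h w

/-- Dyck words of semilength `k`. -/
def IsDyck (k : ℕ) (w : List Bool) : Prop := w.length = 2 * k ∧ BallotFrom 0 w

/-- Insertion of a peak (an up step followed by a down step) at position `i`. -/
def insertPeak : ℕ → List Bool → List Bool
  | 0, w => true :: false :: w
  | _ + 1, [] => []
  | i + 1, x :: w => x :: insertPeak i w

/-- The position of the first peak. -/
def peakIdx : List Bool → ℕ
  | true :: true :: w => peakIdx (true :: w) + 1
  | _ => 0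

/-- The word with its first peak removed. -/
def erasePeak : List Bool → List Bool
  | true :: false :: w => w
  | true :: true :: w => true :: erasePeak (true :: w)
  | w => w

theorem length_insertPeak : ∀ (i : ℕ) (w : List Bool), i ≤ w.length →
    (insertPeak i w).length = w.length + 2
  | 0, w, _ => rfl
  | i + 1, [], h => by simp at h
  | i + 1, x :: w, h => by
    simp only [List.length_cons, add_le_add_iff_right] at h
    simp [insertPeak, length_insertPeak i w h]

theorem ballotFrom_insertPeak : ∀ (i h : ℕ) (w : List Bool), i ≤ w.length →
    (BallotFrom h (insertPeak i w) ↔ BallotFrom h w)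
  | 0, h, w, _ => by simp [insertPeak, BallotFrom]
  | i + 1, h, [], hi => by simp at hi
  | i + 1, h, true :: w, hi => by
    simp only [List.length_cons, add_le_add_iff_right] at hi
    simp [insertPeak, BallotFrom, ballotFrom_insertPeak i _ w hi]
  | i + 1, 0, false :: w, hi => by simp [insertPeak, BallotFrom]
  | i + 1, h + 1, false :: w, hi => by
    simp only [List.length_cons, add_le_add_iff_right] at hi
    simp [insertPeak, BallotFrom, ballotFrom_insertPeak i _ w hi]

theorem IsDyck.insertPeak {k i : ℕ} {w : List Bool} (hw : IsDyck k w) (hi : i ≤ 2 * k) :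
    IsDyck (k + 1) (insertPeak i w) := by
  have hi' : i ≤ w.length := hw.1 ▸ hi
  refine ⟨by rw [length_insertPeak i w hi', hw.1]; ring, ?_⟩
  exact (ballotFrom_insertPeak i 0 w hi').2 hw.2

theorem insertPeak_erasePeak_aux : ∀ (h : ℕ) (w : List Bool), BallotFrom (h + 1) w →
    insertPeak (peakIdx (true :: w)) (erasePeak (true :: w)) = true :: w ∧
      peakIdx (true :: w) ≤ (erasePeak (true :: w)).length
  | h, [], hw => by simp [BallotFrom] at hw
  | h, false :: w, hw => by simp [peakIdx, erasePeak, insertPeak]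
  | h, true :: w, hw => by
    have := insertPeak_erasePeak_aux (h + 1) w hw
    simp [peakIdx, erasePeak, insertPeak, this.1, this.2]

theorem IsDyck.exists_eq_true_cons {k : ℕ} {w : List Bool} (hw : IsDyck (k + 1) w) :
    ∃ u, w = true :: u ∧ BallotFrom 1 u := by
  obtain ⟨hl, hb⟩ := hw
  match w, hl, hb with
  | true :: u, _, hb => exact ⟨u, rfl, hb⟩

theorem IsDyck.insertPeak_erasePeak {k : ℕ} {w : List Bool} (hw : IsDyck (k + 1) w) :
    _root_.insertPeak (peakIdx w) (erasePeak w) = w ∧ peakIdx w ≤ 2 * k ∧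
      IsDyck k (erasePeak w) := by
  obtain ⟨u, rfl, hu⟩ := hw.exists_eq_true_cons
  obtain ⟨h1, h2⟩ := insertPeak_erasePeak_aux 0 u hu
  have hl := length_insertPeak _ _ h2
  rw [h1, hw.1] at hl
  have hl' : (erasePeak (true :: u)).length = 2 * k := by omega
  refine ⟨h1, hl' ▸ h2, hl', ?_⟩
  rw [← ballotFrom_insertPeak _ _ _ h2, h1]
  exact hw.2

theorem peakIdx_insertPeak_le : ∀ (i h : ℕ) (w : List Bool), BallotFrom (h + 1) w →
    i ≤ peakIdx (true :: w) + 1 →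
      peakIdx (insertPeak i (true :: w)) = i ∧ erasePeak (insertPeak i (true :: w)) = true :: w
  | 0, h, w, hw, hi => by simp [insertPeak, peakIdx, erasePeak]
  | 1, h, w, hw, hi => by simp [insertPeak, peakIdx, erasePeak]
  | i + 2, h, [], hw, hi => by simp [BallotFrom] at hw
  | i + 2, h, false :: w, hw, hi => by simp [peakIdx] at hi
  | i + 2, h, true :: w, hw, hi => by
    have := peakIdx_insertPeak_le (i + 1) (h + 1) w hw (by simpa [peakIdx] using hi)
    simp only [insertPeak] at this ⊢
    simp [peakIdx, erasePeak, this.1, this.2]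

theorem peakIdx_insertPeak_ge : ∀ (i h : ℕ) (w : List Bool), BallotFrom (h + 1) w →
    peakIdx (true :: w) ≤ i →
      peakIdx (insertPeak (i + 2) (true :: w)) = peakIdx (true :: w) ∧
        erasePeak (insertPeak (i + 2) (true :: w)) = insertPeak i (erasePeak (true :: w))
  | i, h, [], hw, hi => by simp [BallotFrom] at hw
  | i, h, false :: w, hw, hi => by simp [insertPeak, peakIdx, erasePeak]
  | 0, h, true :: w, hw, hi => by simp [peakIdx] at hi
  | i + 1, h, true :: w, hw, hi => by
    have := peakIdx_insertPeak_ge i (h + 1) w hw (by simpa [peakIdx] using hi)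
    simp only [insertPeak] at this ⊢
    simp [peakIdx, erasePeak, insertPeak, this.1, this.2]

/-! ### Models of the Temperley-Lieb calculus -/

/-- A representation of planar cups (`ins`) and caps (`cap`) on spaces of functions `A k → ℝ`, with
loop value `δ`, and bilinear forms for which caps are adjoint to cups up to the factor `c`. -/
structure TLModel (δ : ℝ) where
  c : ℝ
  A : ℕ → Type
  ins : ∀ k, ℕ → (A k → ℝ) → A (k + 1) → ℝ
  cap : ∀ k, ℕ → (A (k + 1) → ℝ) → A k → ℝ
  one : A 0 → ℝ
  pair : ∀ k, (A k → ℝ) → (A k → ℝ) → ℝ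
  ins_smul : ∀ (k i : ℕ) (r : ℝ) (x : A k → ℝ), ins k i (r • x) = r • ins k i x
  pair_smul : ∀ (k : ℕ) (r : ℝ) (x y : A k → ℝ), pair k x (r • y) = r * pair k x y
  pair_one : pair 0 one one = 1
  pair_ins : ∀ k i x y, i ≤ 2 * k → pair (k + 1) (ins k i x) y = c * pair k x (cap k i y)
  cap_ins_self : ∀ k i x, i ≤ 2 * k → cap k i (ins k i x) = δ • x
  cap_ins_succ : ∀ k i x, i + 1 ≤ 2 * k → cap k i (ins k (i + 1) x) = x
  cap_succ_ins : ∀ k i x, i + 1 ≤ 2 * k → cap k (i + 1) (ins k i x) = x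
  cap_ins_of_le : ∀ k i j x, i ≤ j → j ≤ 2 * k →
    cap (k + 1) i (ins (k + 1) (j + 2) x) = ins k j (cap k i x)
  cap_ins_of_ge : ∀ k i j x, i ≤ j → j ≤ 2 * k →
    cap (k + 1) (j + 2) (ins (k + 1) i x) = ins k i (cap k j x)
  ins_ins : ∀ k i j x, i ≤ j → j ≤ 2 * k →
    ins (k + 1) i (ins k j x) = ins (k + 1) (j + 2) (ins k i x)

namespace TLModel

variable {δ : ℝ} (M : TLModel δ)

/-- The vector of the noncrossing pairing encoded by a Dyck word. -/
def vec : ∀ k, List Bool → M.A k → ℝ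
  | 0, _ => M.one
  | k + 1, w => M.ins k (peakIdx w) (vec k (erasePeak w))

theorem ins_vec {k i : ℕ} {w : List Bool} (hw : IsDyck k w) (hi : i ≤ 2 * k) :
    M.ins k i (M.vec k w) = M.vec (k + 1) (insertPeak i w) := by
  induction k generalizing i w with
  | zero =>
    obtain rfl : i = 0 := by omega
    rfl
  | succ k ih =>
    obtain ⟨u, rfl, hu⟩ := hw.exists_eq_true_cons
    rcases Nat.lt_or_ge i (peakIdx (true :: u) + 2) with h | h
    · obtain ⟨h1, h2⟩ := peakIdx_insertPeak_le i 0 u hu (by omega)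
      conv_rhs => rw [vec, h1, h2]
    · obtain ⟨i, rfl⟩ : ∃ j, i = j + 2 := ⟨i - 2, by omega⟩
      obtain ⟨h1, h2⟩ := peakIdx_insertPeak_ge i 0 u hu (by omega)
      obtain ⟨-, -, h5⟩ := hw.insertPeak_erasePeak
      conv_rhs => rw [vec, h1, h2]
      rw [← ih h5 (by omega), M.ins_ins _ _ _ _ (by omega) (by omega), vec]

theorem exists_eq_insertPeak {k : ℕ} {w : List Bool} (hw : IsDyck (k + 1) w) :
    ∃ i u, i ≤ 2 * k ∧ IsDyck k u ∧ w = insertPeak i u := by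
  obtain ⟨h1, h2, h3⟩ := hw.insertPeak_erasePeak
  exact ⟨_, _, h2, h3, h1.symm⟩

theorem exists_cap_vec (δ : ℝ) {k i : ℕ} {w : List Bool} (hw : IsDyck (k + 1) w) (hi : i ≤ 2 * k) :
    ∃ (e : ℕ) (u : List Bool), IsDyck k u ∧
      ∀ M : TLModel δ, M.cap k i (M.vec (k + 1) w) = δ ^ e • M.vec k u := by
  induction k generalizing i w with
  | zero =>
    obtain ⟨j, u, hj, hu, rfl⟩ := exists_eq_insertPeak hw
    refine ⟨1, u, hu, fun M => ?_⟩
    obtain rfl : i = 0 := by omega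
    obtain rfl : j = 0 := by omega
    rw [← M.ins_vec hu hj, M.cap_ins_self _ _ _ (by omega), pow_one]
  | succ k ih =>
    obtain ⟨j, u, hj, hu, rfl⟩ := exists_eq_insertPeak hw
    rcases lt_trichotomy i j with h | rfl | h
    · obtain ⟨j, rfl⟩ : ∃ l, j = l + 1 := ⟨j - 1, by omega⟩
      rcases eq_or_lt_of_le (Nat.lt_succ_iff.1 h) with rfl | h
      · refine ⟨0, u, hu, fun M => ?_⟩
        rw [← M.ins_vec hu hj, M.cap_ins_succ _ _ _ (by omega), pow_zero, one_smul]
      · obtain ⟨j, rfl⟩ : ∃ l, j = l + 1 := ⟨j - 1, by omega⟩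
        obtain ⟨e, v, hv, h2⟩ := ih hu (i := i) (by omega)
        refine ⟨e, insertPeak j v, hv.insertPeak (by omega), fun M => ?_⟩
        rw [← M.ins_vec hu hj, M.cap_ins_of_le _ _ _ _ (by omega) (by omega), h2, M.ins_smul,
          M.ins_vec hv (by omega)]
    · refine ⟨1, u, hu, fun M => ?_⟩
      rw [← M.ins_vec hu hj, M.cap_ins_self _ _ _ (by omega), pow_one]
    · obtain ⟨i, rfl⟩ : ∃ l, i = l + 1 := ⟨i - 1, by omega⟩
      rcases eq_or_lt_of_le (Nat.lt_succ_iff.1 h) with rfl | h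
      · refine ⟨0, u, hu, fun M => ?_⟩
        rw [← M.ins_vec hu hj, M.cap_succ_ins _ _ _ (by omega), pow_zero, one_smul]
      · obtain ⟨i, rfl⟩ : ∃ l, i = l + 1 := ⟨i - 1, by omega⟩
        obtain ⟨e, v, hv, h2⟩ := ih hu (i := i) (by omega)
        refine ⟨e, insertPeak j v, hv.insertPeak (by omega), fun M => ?_⟩
        rw [← M.ins_vec hu hj, M.cap_ins_of_ge _ _ _ _ (by omega) (by omega), h2, M.ins_smul,
          M.ins_vec hv (by omega)]

/-- The Gram matrix of the vectors of Dyck words is the same in all models, up to normalization. -/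
theorem exists_pair_vec (δ : ℝ) {k : ℕ} {w u : List Bool} (hw : IsDyck k w) (hu : IsDyck k u) :
    ∃ e : ℕ, ∀ M : TLModel δ, M.pair k (M.vec k w) (M.vec k u) = M.c ^ k * δ ^ e := by
  induction k generalizing w u with
  | zero => exact ⟨0, fun M => by simp [vec, M.pair_one]⟩
  | succ k ih =>
    obtain ⟨j, v, hj, hv, rfl⟩ := exists_eq_insertPeak hw
    obtain ⟨e, t, ht, h⟩ := exists_cap_vec δ hu hj
    obtain ⟨e', h'⟩ := ih hv ht
    refine ⟨e + e', fun M => ?_⟩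
    rw [← M.ins_vec hv hj, M.pair_ins _ _ _ _ hj, h, M.pair_smul, h']
    ring

theorem pair_vec_self {k : ℕ} {w : List Bool} (hw : IsDyck k w) :
    M.pair k (M.vec k w) (M.vec k w) = (M.c * δ) ^ k := by
  induction k generalizing w with
  | zero => simp [vec, M.pair_one]
  | succ k ih =>
    obtain ⟨j, v, hj, hv, rfl⟩ := exists_eq_insertPeak hw
    rw [← M.ins_vec hv hj, M.pair_ins _ _ _ _ hj, M.cap_ins_self _ _ _ hj, M.pair_smul, ih hv]
    ring

end TLModel

/-! ### Extension by zero -/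

open Classical in
/-- Extension by zero of a function on a subtype. -/
noncomputable def extendZero {α : Type*} {P : α → Prop} (f : {w // P w} → ℝ) (w : α) : ℝ :=
  if h : P w then f ⟨w, h⟩ else 0

theorem extendZero_of_mem {α : Type*} {P : α → Prop} (f : {w // P w} → ℝ) {w : α} (h : P w) :
    extendZero f w = f ⟨w, h⟩ := dif_pos h

theorem extendZero_of_not_mem {α : Type*} {P : α → Prop} (f : {w // P w} → ℝ) {w : α}
    (h : ¬ P w) : extendZero f w = 0 := dif_neg h

theorem extendZero_smul {α : Type*} {P : α → Prop} (r : ℝ) (f : {w // P w} → ℝ) :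
    extendZero (r • f) = fun w => r * extendZero f w := by
  funext w
  by_cases h : P w
  · simp [extendZero_of_mem _ h]
  · simp [extendZero_of_not_mem _ h]

theorem cons_le_cons_iff_of_linear {x y : Bool} {u w : List Bool} :
    (x :: u ≤ y :: w) ↔ x < y ∨ x = y ∧ u ≤ w := by
  rw [← not_lt, ← not_lt, List.cons_lt_cons_iff]
  rcases lt_trichotomy x y with h | h | h
  · simp [h, h.not_gt, h.ne']
  · simp [h]
  · simp [h, h.not_gt, h.ne']

/-! ### The path model: local computations -/

/-- Creation of a pair of steps at position `i` in the path basis, for paths starting at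
height `h`. -/
noncomputable def pathIns (a : ℕ → ℝ) : ℕ → ℕ → (List Bool → ℝ) → List Bool → ℝ
  | 0, _, f, true :: false :: w => f w
  | 0, h + 1, f, false :: true :: w => (a h)⁻¹ * f w
  | i + 1, h, f, true :: w => pathIns a i (h + 1) (fun u => f (true :: u)) w
  | i + 1, h + 1, f, false :: w => pathIns a i h (fun u => f (false :: u)) w
  | _, _, _, _ => 0

/-- Annihilation of a pair of steps at position `i` in the path basis, for paths starting at
height `h`. -/
noncomputable def pathCap (a : ℕ → ℝ) : ℕ → ℕ → (List Bool → ℝ) → List Bool → ℝ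
  | 0, 0, f, w => a 0 * f (true :: false :: w)
  | 0, h + 1, f, w => a (h + 1) * f (true :: false :: w) + f (false :: true :: w)
  | i + 1, h, f, true :: w => pathCap a i (h + 1) (fun u => f (true :: u)) w
  | i + 1, h + 1, f, false :: w => pathCap a i h (fun u => f (false :: u)) w
  | _, _, _, _ => 0

section Path

variable {a : ℕ → ℝ}

theorem pathIns_mul : ∀ (i h : ℕ) (r : ℝ) (f : List Bool → ℝ) (w : List Bool),
    pathIns a i h (fun u => r * f u) w = r * pathIns a i h f w
  | 0, _, r, f, [] => by simp [pathIns]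
  | 0, _, r, f, [true] => by simp [pathIns]
  | 0, _, r, f, true :: true :: w => by simp [pathIns]
  | 0, _, r, f, true :: false :: w => by simp [pathIns]
  | 0, 0, r, f, false :: w => by simp [pathIns]
  | 0, _ + 1, r, f, [false] => by simp [pathIns]
  | 0, _ + 1, r, f, false :: false :: w => by simp [pathIns]
  | 0, h + 1, r, f, false :: true :: w => by simp only [pathIns]; ring
  | i + 1, h, r, f, [] => by simp [pathIns]
  | i + 1, h, r, f, true :: w => by simp [pathIns, pathIns_mul]
  | i + 1, 0, r, f, false :: w => by simp [pathIns]
  | i + 1, h + 1, r, f, false :: w => by simp [pathIns, pathIns_mul]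

theorem pathIns_add : ∀ (i h : ℕ) (f g : List Bool → ℝ) (w : List Bool),
    pathIns a i h (fun u => f u + g u) w = pathIns a i h f w + pathIns a i h g w
  | 0, _, f, g, [] => by simp [pathIns]
  | 0, _, f, g, [true] => by simp [pathIns]
  | 0, _, f, g, true :: true :: w => by simp [pathIns]
  | 0, _, f, g, true :: false :: w => by simp [pathIns]
  | 0, 0, f, g, false :: w => by simp [pathIns]
  | 0, _ + 1, f, g, [false] => by simp [pathIns]
  | 0, _ + 1, f, g, false :: false :: w => by simp [pathIns]
  | 0, h + 1, f, g, false :: true :: w => by simp only [pathIns]; ring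
  | i + 1, h, f, g, [] => by simp [pathIns]
  | i + 1, h, f, g, true :: w => by simp [pathIns, pathIns_add]
  | i + 1, 0, f, g, false :: w => by simp [pathIns]
  | i + 1, h + 1, f, g, false :: w => by simp [pathIns, pathIns_add]

theorem pathCap_mul : ∀ (i h : ℕ) (r : ℝ) (f : List Bool → ℝ) (w : List Bool),
    pathCap a i h (fun u => r * f u) w = r * pathCap a i h f w
  | 0, 0, r, f, w => by simp only [pathCap]; ring
  | 0, h + 1, r, f, w => by simp only [pathCap]; ring
  | i + 1, h, r, f, [] => by simp [pathCap]
  | i + 1, h, r, f, true :: w => by simp [pathCap, pathCap_mul]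
  | i + 1, 0, r, f, false :: w => by simp [pathCap]
  | i + 1, h + 1, r, f, false :: w => by simp [pathCap, pathCap_mul]

theorem pathCap_zero (i h : ℕ) (w : List Bool) : pathCap a i h (fun _ => 0) w = 0 := by
  simpa using pathCap_mul (a := a) i h 0 (fun _ => 0) w

theorem pathIns_zero (i h : ℕ) (w : List Bool) : pathIns a i h (fun _ => 0) w = 0 := by
  simpa using pathIns_mul (a := a) i h 0 (fun _ => 0) w

theorem pathCap_congr : ∀ (i h : ℕ) (f g : List Bool → ℝ) (w : List Bool), i ≤ w.length →
    BallotFrom h w → (∀ u, u.length = w.length + 2 → BallotFrom h u → f u = g u) →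
    pathCap a i h f w = pathCap a i h g w
  | 0, 0, f, g, w, hi, hw, H => by
    simp only [pathCap]; rw [H _ (by simp) (by simpa [BallotFrom])]
  | 0, h + 1, f, g, w, hi, hw, H => by
    simp only [pathCap]
    rw [H _ (by simp) (by simpa [BallotFrom]), H _ (by simp) (by simpa [BallotFrom])]
  | i + 1, h, f, g, [], hi, hw, H => by simp at hi
  | i + 1, h, f, g, true :: w, hi, hw, H => by
    simp only [pathCap]
    exact pathCap_congr i _ _ _ w (by simpa using hi) hw
      fun u hu hb => H _ (by simpa using hu) hb
  | i + 1, 0, f, g, false :: w, hi, hw, H => hw.elim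
  | i + 1, h + 1, f, g, false :: w, hi, hw, H => by
    simp only [pathCap]
    exact pathCap_congr i _ _ _ w (by simpa using hi) hw
      fun u hu hb => H _ (by simpa using hu) hb

theorem pathIns_congr : ∀ (i h : ℕ) (f g : List Bool → ℝ) (w : List Bool),
    BallotFrom h w → (∀ u, u.length + 2 = w.length → BallotFrom h u → f u = g u) →
    pathIns a i h f w = pathIns a i h g w
  | 0, _, f, g, [], hw, H => by simp [pathIns]
  | 0, _, f, g, [true], hw, H => by simp [pathIns]
  | 0, _, f, g, true :: true :: w, hw, H => by simp [pathIns]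
  | 0, _, f, g, true :: false :: w, hw, H => by
    simp only [pathIns]; exact H w rfl hw
  | 0, 0, f, g, false :: w, hw, H => by simp [pathIns]
  | 0, _ + 1, f, g, [false], hw, H => by simp [pathIns]
  | 0, _ + 1, f, g, false :: false :: w, hw, H => by simp [pathIns]
  | 0, h + 1, f, g, false :: true :: w, hw, H => by
    simp only [pathIns]; rw [H w rfl hw]
  | i + 1, h, f, g, [], hw, H => by simp [pathIns]
  | i + 1, h, f, g, true :: w, hw, H => by
    simp only [pathIns]
    exact pathIns_congr i _ _ _ w hw fun u hu hb => H _ (by simpa using hu) hb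
  | i + 1, 0, f, g, false :: w, hw, H => by simp [pathIns]
  | i + 1, h + 1, f, g, false :: w, hw, H => by
    simp only [pathIns]
    exact pathIns_congr i _ _ _ w hw fun u hu hb => H _ (by simpa using hu) hb

theorem pathCap_pathIns_self {δ : ℝ} (h0 : a 0 = δ) (hs : ∀ h, a (h + 1) + (a h)⁻¹ = δ) :
    ∀ (i h : ℕ) (f : List Bool → ℝ) (w : List Bool), i ≤ w.length → BallotFrom h w →
      pathCap a i h (pathIns a i h f) w = δ * f w
  | 0, 0, f, w, hi, hw => by simp [pathCap, pathIns, h0]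
  | 0, h + 1, f, w, hi, hw => by simp only [pathCap, pathIns]; rw [← hs h]; ring
  | i + 1, h, f, [], hi, hw => by simp at hi
  | i + 1, h, f, true :: w, hi, hw => by
    simp only [pathCap, pathIns]
    exact pathCap_pathIns_self h0 hs i _ _ w (by simpa using hi) hw
  | i + 1, 0, f, false :: w, hi, hw => hw.elim
  | i + 1, h + 1, f, false :: w, hi, hw => by
    simp only [pathCap, pathIns]
    exact pathCap_pathIns_self h0 hs i _ _ w (by simpa using hi) hw

theorem pathCap_pathIns_succ (ha : ∀ h, a h ≠ 0) :
    ∀ (i h : ℕ) (f : List Bool → ℝ) (w : List Bool), i + 1 ≤ w.length → BallotFrom h w →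
      pathCap a i h (pathIns a (i + 1) h f) w = f w
  | i, h, f, [], hi, hw => by simp at hi
  | 0, 0, f, true :: w, hi, hw => by simp [pathCap, pathIns, ha]
  | 0, h + 1, f, true :: w, hi, hw => by simp [pathCap, pathIns, ha]
  | 0, 0, f, false :: w, hi, hw => hw.elim
  | 0, h + 1, f, false :: w, hi, hw => by cases h <;> simp [pathCap, pathIns]
  | i + 1, h, f, true :: w, hi, hw => by
    simp only [pathCap]
    exact pathCap_pathIns_succ ha i _ _ w (by simpa using hi) hw
  | i + 1, 0, f, false :: w, hi, hw => hw.elim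
  | i + 1, h + 1, f, false :: w, hi, hw => by
    simp only [pathCap]
    exact pathCap_pathIns_succ ha i _ _ w (by simpa using hi) hw

theorem pathCap_succ_pathIns (ha : ∀ h, a h ≠ 0) :
    ∀ (i h : ℕ) (f : List Bool → ℝ) (w : List Bool), i + 1 ≤ w.length → BallotFrom h w →
      pathCap a (i + 1) h (pathIns a i h f) w = f w
  | i, h, f, [], hi, hw => by simp at hi
  | 0, h, f, true :: w, hi, hw => by simp [pathCap, pathIns]
  | 0, 0, f, false :: w, hi, hw => hw.elim
  | 0, 1, f, false :: w, hi, hw => by simp [pathCap, pathIns, ha]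
  | 0, h + 2, f, false :: w, hi, hw => by simp [pathCap, pathIns, ha]
  | i + 1, h, f, true :: w, hi, hw => by
    rw [pathCap]
    exact pathCap_succ_pathIns ha i _ _ w (by simpa using hi) hw
  | i + 1, 0, f, false :: w, hi, hw => hw.elim
  | i + 1, h + 1, f, false :: w, hi, hw => by
    rw [pathCap]
    exact pathCap_succ_pathIns ha i _ _ w (by simpa using hi) hw

theorem pathCap_pathIns_of_le :
    ∀ (i j h : ℕ) (f : List Bool → ℝ) (w : List Bool), i ≤ j →
      pathCap a i h (pathIns a (j + 2) h f) w = pathIns a j h (pathCap a i h f) w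
  | 0, j, 0, f, w, hij => by
    simp only [pathCap, pathIns]
    exact (pathIns_mul ..).symm
  | 0, j, h + 1, f, w, hij => by
    simp only [pathCap, pathIns]
    rw [pathIns_add, pathIns_mul]
  | i + 1, 0, h, f, w, hij => by simp at hij
  | i + 1, j + 1, h, f, [], hij => by simp [pathCap, pathIns]
  | i + 1, j + 1, h, f, true :: w, hij => by
    rw [pathCap, pathIns]
    exact pathCap_pathIns_of_le i j _ _ w (by simpa using hij)
  | i + 1, j + 1, 0, f, false :: w, hij => by simp [pathCap, pathIns]
  | i + 1, j + 1, h + 1, f, false :: w, hij => by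
    rw [pathCap, pathIns]
    exact pathCap_pathIns_of_le i j _ _ w (by simpa using hij)

theorem pathCap_pathIns_of_ge :
    ∀ (i j h : ℕ) (f : List Bool → ℝ) (w : List Bool), i ≤ j →
      pathCap a (j + 2) h (pathIns a i h f) w = pathIns a i h (pathCap a j h f) w
  | 0, j, _, f, [], _ => by simp [pathIns, pathCap]
  | 0, j, _, f, [true], _ => by simp [pathIns, pathCap]
  | 0, j, _, f, true :: true :: w, _ => by simp [pathIns, pathCap, pathCap_zero]
  | 0, j, _, f, true :: false :: w, _ => by simp [pathIns, pathCap]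
  | 0, j, 0, f, false :: w, _ => by simp [pathIns, pathCap]
  | 0, j, _ + 1, f, [false], _ => by simp [pathIns, pathCap]
  | 0, j, 1, f, false :: false :: w, _ => by simp [pathIns, pathCap]
  | 0, j, _ + 2, f, false :: false :: w, _ => by simp [pathIns, pathCap, pathCap_zero]
  | 0, j, h + 1, f, false :: true :: w, _ => by
    simp only [pathIns, pathCap]; exact pathCap_mul ..
  | i + 1, 0, h, f, w, hij => by simp at hij
  | i + 1, j + 1, h, f, [], hij => by simp [pathCap, pathIns]
  | i + 1, j + 1, h, f, true :: w, hij => by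
    rw [pathCap, pathIns]
    exact pathCap_pathIns_of_ge i j _ _ w (by simpa using hij)
  | i + 1, j + 1, 0, f, false :: w, hij => by simp [pathCap, pathIns]
  | i + 1, j + 1, h + 1, f, false :: w, hij => by
    rw [pathCap, pathIns]
    exact pathCap_pathIns_of_ge i j _ _ w (by simpa using hij)

theorem pathIns_pathIns :
    ∀ (i j h : ℕ) (f : List Bool → ℝ) (w : List Bool), i ≤ j →
      pathIns a i h (pathIns a j h f) w = pathIns a (j + 2) h (pathIns a i h f) w
  | 0, j, _, f, [], _ => by simp [pathIns]
  | 0, j, _, f, [true], _ => by simp [pathIns]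
  | 0, j, _, f, true :: true :: w, _ => by simp [pathIns, pathIns_zero]
  | 0, j, _, f, true :: false :: w, _ => by simp [pathIns]
  | 0, j, 0, f, false :: w, _ => by simp [pathIns]
  | 0, j, _ + 1, f, [false], _ => by simp [pathIns]
  | 0, j, 1, f, false :: false :: w, _ => by simp [pathIns]
  | 0, j, _ + 2, f, false :: false :: w, _ => by simp [pathIns, pathIns_zero]
  | 0, j, h + 1, f, false :: true :: w, _ => by
    simp only [pathIns]; exact (pathIns_mul ..).symm
  | i + 1, 0, h, f, w, hij => by simp at hij
  | i + 1, j + 1, h, f, [], hij => by simp [pathIns]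
  | i + 1, j + 1, h, f, true :: w, hij => by
    rw [pathIns, pathIns]
    exact pathIns_pathIns i j _ _ w (by simpa using hij)
  | i + 1, j + 1, 0, f, false :: w, hij => by simp [pathIns]
  | i + 1, j + 1, h + 1, f, false :: w, hij => by
    rw [pathIns, pathIns]
    exact pathIns_pathIns i j _ _ w (by simpa using hij)

/-- The squared norm of a path in the path basis, and `0` for words which are not paths. -/
noncomputable def pathNorm (a : ℕ → ℝ) : ℕ → List Bool → ℝ
  | h, [] => if h = 0 then 1 else 0
  | h, true :: w => pathNorm a (h + 1) w
  | 0, false :: _ => 0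
  | h + 1, false :: w => a h * pathNorm a h w

theorem pathNorm_of_not_ballotFrom : ∀ (h : ℕ) (w : List Bool), ¬ BallotFrom h w →
    pathNorm a h w = 0
  | h, [], hw => by simpa [pathNorm, BallotFrom] using hw
  | h, true :: w, hw => by
    rw [pathNorm]; exact pathNorm_of_not_ballotFrom _ w hw
  | 0, false :: w, hw => by simp [pathNorm]
  | h + 1, false :: w, hw => by
    rw [pathNorm, pathNorm_of_not_ballotFrom h w hw, mul_zero]

theorem pathNorm_ne_zero (ha : ∀ h, a h ≠ 0) : ∀ (h : ℕ) (w : List Bool), BallotFrom h w →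
    pathNorm a h w ≠ 0
  | h, [], hw => by simpa [pathNorm, BallotFrom] using hw
  | h, true :: w, hw => by
    rw [pathNorm]; exact pathNorm_ne_zero ha _ w hw
  | 0, false :: w, hw => hw.elim
  | h + 1, false :: w, hw => by
    rw [pathNorm]; exact mul_ne_zero (ha h) (pathNorm_ne_zero ha h w hw)

theorem pathIns_insertPeak : ∀ (i h : ℕ) (f : List Bool → ℝ) (w : List Bool), i ≤ w.length →
    BallotFrom h w → pathIns a i h f (insertPeak i w) = f w
  | 0, h, f, w, _, _ => by simp [insertPeak, pathIns]
  | i + 1, h, f, [], hi, _ => by simp at hi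
  | i + 1, h, f, true :: w, hi, hw => by
    simp only [insertPeak, pathIns]
    exact pathIns_insertPeak i _ _ w (by simpa using hi) hw
  | i + 1, 0, f, false :: w, hi, hw => hw.elim
  | i + 1, h + 1, f, false :: w, hi, hw => by
    simp only [insertPeak, pathIns]
    exact pathIns_insertPeak i _ _ w (by simpa using hi) hw

theorem exists_of_pathIns_ne_zero : ∀ (i h : ℕ) (f : List Bool → ℝ) (w : List Bool),
    pathIns a i h f w ≠ 0 → ∃ u, f u ≠ 0 ∧ u.length + 2 = w.length ∧ w ≤ insertPeak i u
  | 0, _, f, [], H => by simp [pathIns] at H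
  | 0, _, f, [true], H => by simp [pathIns] at H
  | 0, _, f, true :: true :: w, H => by simp [pathIns] at H
  | 0, _, f, true :: false :: w, H => ⟨w, by simpa [pathIns] using H, rfl, le_rfl⟩
  | 0, 0, f, false :: w, H => by simp [pathIns] at H
  | 0, _ + 1, f, [false], H => by simp [pathIns] at H
  | 0, _ + 1, f, false :: false :: w, H => by simp [pathIns] at H
  | 0, h + 1, f, false :: true :: w, H => by
    simp only [pathIns, ne_eq, mul_eq_zero, not_or] at H
    exact ⟨w, H.2, rfl, cons_le_cons_iff_of_linear.2 (Or.inl (by decide))⟩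
  | i + 1, h, f, [], H => by simp [pathIns] at H
  | i + 1, h, f, true :: w, H => by
    simp only [pathIns] at H
    obtain ⟨u, h1, h2, h3⟩ := exists_of_pathIns_ne_zero i _ _ w H
    exact ⟨true :: u, h1, by simpa using h2, List.cons_le_cons _ h3⟩
  | i + 1, 0, f, false :: w, H => by simp [pathIns] at H
  | i + 1, h + 1, f, false :: w, H => by
    simp only [pathIns] at H
    obtain ⟨u, h1, h2, h3⟩ := exists_of_pathIns_ne_zero i _ _ w H
    exact ⟨false :: u, h1, by simpa using h2, List.cons_le_cons _ h3⟩

theorem insertPeak_le_insertPeak : ∀ (i : ℕ) (u w : List Bool), u.length = w.length →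
    u ≤ w → insertPeak i u ≤ insertPeak i w
  | 0, u, w, _, H => List.cons_le_cons _ (List.cons_le_cons _ H)
  | i + 1, [], w, hl, H => by
    obtain rfl : w = [] := List.eq_nil_of_length_eq_zero hl.symm
    exact le_rfl
  | i + 1, x :: u, [], hl, H => by simp at hl
  | i + 1, x :: u, y :: w, hl, H => by
    simp only [insertPeak]
    rw [cons_le_cons_iff_of_linear] at H ⊢
    rcases H with H | ⟨rfl, H⟩
    · exact Or.inl H
    · exact Or.inr ⟨rfl, insertPeak_le_insertPeak i u w (by simpa using hl) H⟩

end Path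

/-! ### Sums and products over words -/

@[to_additive]
theorem prod_ofFn_zero {α β : Type*} [Fintype α] [CommMonoid β] (F : List α → β) :
    ∏ x : Fin 0 → α, F (List.ofFn x) = F [] := by
  simp

@[to_additive]
theorem prod_ofFn_succ {α β : Type*} [Fintype α] [CommMonoid β] (N : ℕ) (F : List α → β) :
    ∏ x : Fin (N + 1) → α, F (List.ofFn x) =
      ∏ a : α, ∏ x : Fin N → α, F (a :: List.ofFn x) := by
  rw [← (Fin.consEquiv fun _ => α).prod_comp, Fintype.prod_prod_type]
  simp [Fin.consEquiv]

@[to_additive]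
theorem prod_subtype_eq_prod_ofFn {α β : Type*} [Fintype α] [CommMonoid β] {N : ℕ}
    {P : List α → Prop} [Fintype {w // P w}] (hP : ∀ w, P w → w.length = N) (F : List α → β)
    (hF : ∀ w, w.length = N → ¬ P w → F w = 1) :
    ∏ w : {w // P w}, F w.1 = ∏ x : Fin N → α, F (List.ofFn x) := by
  classical
  have h1 : ∏ x : Fin N → α, F (List.ofFn x) =
      ∏ x : {x : Fin N → α // P (List.ofFn x)}, F (List.ofFn x.1) := by
    rw [← Finset.prod_subtype (Finset.univ.filter fun x : Fin N → α => P (List.ofFn x)) (by simp)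
      fun x => F (List.ofFn x), Finset.prod_filter]
    refine Finset.prod_congr rfl fun x _ => ?_
    split_ifs with h
    · rfl
    · exact hF _ (by simp) h
  rw [h1]
  symm
  refine Fintype.prod_bijective (fun x => ⟨List.ofFn x.1, x.2⟩) ⟨?_, ?_⟩ _ _ fun x => rfl
  · intro x y h
    exact Subtype.ext (List.ofFn_injective (congrArg Subtype.val h))
  · rintro ⟨w, hw⟩
    obtain rfl := hP w hw
    exact ⟨⟨w.get, by simpa using hw⟩, by simp⟩

noncomputable instance (k : ℕ) : Fintype {w : List Bool // IsDyck k w} :=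
  haveI : Finite {w : List Bool // IsDyck k w} :=
    (List.finite_length_eq Bool (2 * k)).subset fun _ h => h.1
  Fintype.ofFinite _

/-! ### The path model -/

/-- The bilinear form of the path basis, for paths of length `N` starting at height `h`. -/
noncomputable def pathPair (a : ℕ → ℝ) (N h : ℕ) (f g : List Bool → ℝ) : ℝ :=
  ∑ x : Fin N → Bool, pathNorm a h (List.ofFn x) * f (List.ofFn x) * g (List.ofFn x)

section Path

variable {a : ℕ → ℝ}

theorem pathPair_succ_zero (N : ℕ) (f g : List Bool → ℝ) : pathPair a (N + 1) 0 f g =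
    pathPair a N 1 (fun u => f (true :: u)) (fun u => g (true :: u)) := by
  simp only [pathPair]
  rw [sum_ofFn_succ N fun w => pathNorm a 0 w * f w * g w]
  simp [pathNorm]

theorem pathPair_succ_succ (N h : ℕ) (f g : List Bool → ℝ) : pathPair a (N + 1) (h + 1) f g =
    pathPair a N (h + 2) (fun u => f (true :: u)) (fun u => g (true :: u)) +
      a h * pathPair a N h (fun u => f (false :: u)) (fun u => g (false :: u)) := by
  simp only [pathPair]
  rw [sum_ofFn_succ N fun w => pathNorm a (h + 1) w * f w * g w]
  simp [pathNorm, Finset.mul_sum, mul_assoc]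

theorem pathPair_zero_left (N h : ℕ) (g : List Bool → ℝ) :
    pathPair a N h (fun _ => 0) g = 0 := by
  simp [pathPair]

theorem pathPair_pathIns (ha : ∀ h, a h ≠ 0) : ∀ (i N h : ℕ) (f g : List Bool → ℝ), i ≤ N →
    pathPair a (N + 2) h (pathIns a i h f) g = pathPair a N h f (pathCap a i h g)
  | 0, N, 0, f, g, _ => by
    rw [pathPair_succ_zero, pathPair_succ_succ]
    simp only [pathIns, pathPair_zero_left, pathCap, zero_add]
    simp only [pathPair, Finset.mul_sum]
    exact Finset.sum_congr rfl fun x _ => by ring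
  | 0, N, h + 1, f, g, _ => by
    rw [pathPair_succ_succ, pathPair_succ_succ]
    have h2 : pathPair a (N + 1) h (fun u => pathIns a 0 (h + 1) f (false :: u))
        (fun u => g (false :: u)) = (a h)⁻¹ * pathPair a N (h + 1) f
          (fun u => g (false :: true :: u)) := by
      cases h with
      | zero =>
        rw [pathPair_succ_zero]
        simp only [pathIns, pathPair, Finset.mul_sum]
        exact Finset.sum_congr rfl fun x _ => by ring
      | succ h =>
        rw [pathPair_succ_succ]
        simp only [pathIns, pathPair_zero_left, mul_zero, add_zero]
        simp only [pathPair, Finset.mul_sum]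
        exact Finset.sum_congr rfl fun x _ => by ring
    rw [h2, mul_inv_cancel_left₀ (ha h)]
    simp only [pathIns, pathPair_zero_left, pathCap, zero_add]
    simp only [pathPair, Finset.mul_sum, ← Finset.sum_add_distrib]
    exact Finset.sum_congr rfl fun x _ => by ring
  | i + 1, 0, h, f, g, hi => by simp at hi
  | i + 1, N + 1, 0, f, g, hi => by
    rw [pathPair_succ_zero, pathPair_succ_zero]
    simp only [pathIns, pathCap]
    exact pathPair_pathIns ha i N _ _ _ (by simpa using hi)
  | i + 1, N + 1, h + 1, f, g, hi => by
    rw [pathPair_succ_succ (N + 2), pathPair_succ_succ N]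
    simp only [pathIns, pathCap]
    rw [pathPair_pathIns ha i N _ _ _ (by simpa using hi),
      pathPair_pathIns ha i N _ _ _ (by simpa using hi)]

theorem pathPair_congr {N h : ℕ} {f g f' g' : List Bool → ℝ}
    (hf : ∀ u, u.length = N → BallotFrom h u → f u = f' u)
    (hg : ∀ u, u.length = N → BallotFrom h u → g u = g' u) :
    pathPair a N h f g = pathPair a N h f' g' := by
  refine Finset.sum_congr rfl fun x _ => ?_
  by_cases hx : BallotFrom h (List.ofFn x)
  · rw [hf _ (by simp) hx, hg _ (by simp) hx]
  · simp [pathNorm_of_not_ballotFrom _ _ hx]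

theorem eq_of_extendZero {k : ℕ} {x y : {w : List Bool // IsDyck k w} → ℝ}
    (h : ∀ w, IsDyck k w → extendZero x w = extendZero y w) : x = y := by
  funext w
  have := h w.1 w.2
  rwa [extendZero_of_mem _ w.2, extendZero_of_mem _ w.2] at this

/-- The operation `pathIns` on functions of Dyck words. -/
noncomputable def dyckIns (a : ℕ → ℝ) (k i : ℕ) (x : {w : List Bool // IsDyck k w} → ℝ)
    (w : {w : List Bool // IsDyck (k + 1) w}) : ℝ :=
  pathIns a i 0 (extendZero x) w.1

/-- The operation `pathCap` on functions of Dyck words. -/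
noncomputable def dyckCap (a : ℕ → ℝ) (k i : ℕ) (x : {w : List Bool // IsDyck (k + 1) w} → ℝ)
    (w : {w : List Bool // IsDyck k w}) : ℝ :=
  pathCap a i 0 (extendZero x) w.1

theorem dyckIns_comp (k i : ℕ) {x : {w : List Bool // IsDyck k w} → ℝ} {f : List Bool → ℝ}
    (hf : ∀ w, IsDyck k w → extendZero x w = f w) (w : List Bool) (hw : IsDyck (k + 1) w) :
    extendZero (dyckIns a k i x) w = pathIns a i 0 f w := by
  rw [extendZero_of_mem _ hw]
  refine pathIns_congr _ _ _ _ _ hw.2 fun u hu hb => hf _ ⟨?_, hb⟩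
  have := hw.1
  dsimp only at hu
  omega

theorem dyckCap_comp (k i : ℕ) (hi : i ≤ 2 * k) {x : {w : List Bool // IsDyck (k + 1) w} → ℝ}
    {f : List Bool → ℝ} (hf : ∀ w, IsDyck (k + 1) w → extendZero x w = f w) (w : List Bool)
    (hw : IsDyck k w) : extendZero (dyckCap a k i x) w = pathCap a i 0 f w := by
  rw [extendZero_of_mem _ hw]
  refine pathCap_congr _ _ _ _ _ (hw.1.symm ▸ hi) hw.2 fun u hu hb => hf _ ⟨?_, hb⟩
  have := hw.1
  dsimp only at hu
  omega

/-- The model of the Temperley-Lieb calculus on the path basis. -/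
noncomputable def pathModel (a : ℕ → ℝ) (ha : ∀ h, a h ≠ 0) (δ : ℝ) (h0 : a 0 = δ)
    (hs : ∀ h, a (h + 1) + (a h)⁻¹ = δ) : TLModel δ where
  c := 1
  A k := {w : List Bool // IsDyck k w}
  ins := dyckIns a
  cap := dyckCap a
  one _ := 1
  pair k x y := pathPair a (2 * k) 0 (extendZero x) (extendZero y)
  ins_smul k i r x := by
    funext w
    simp only [dyckIns, extendZero_smul, pathIns_mul, Pi.smul_apply, smul_eq_mul]
  pair_smul k r x y := by
    simp only [extendZero_smul, pathPair, Finset.mul_sum]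
    exact Finset.sum_congr rfl fun x _ => by ring
  pair_one := by
    have h : IsDyck 0 [] := ⟨rfl, rfl⟩
    simp [pathPair, pathNorm, extendZero_of_mem _ h]
  pair_ins k i x y hi := by
    rw [one_mul, pathPair_congr (f' := pathIns a i 0 (extendZero x)) (g' := extendZero y)
      (fun u hu hb => dyckIns_comp k i (fun _ _ => rfl) u ⟨hu, hb⟩) (fun _ _ _ => rfl),
      pathPair_congr (f := extendZero x) (f' := extendZero x)
        (g' := pathCap a i 0 (extendZero y)) (fun _ _ _ => rfl)
        (fun u hu hb => dyckCap_comp k i hi (fun _ _ => rfl) u ⟨hu, hb⟩)]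
    exact pathPair_pathIns ha i (2 * k) 0 _ _ hi
  cap_ins_self k i x hi := eq_of_extendZero fun w hw => by
    rw [dyckCap_comp k i hi (dyckIns_comp k i fun _ _ => rfl) w hw, extendZero_smul]
    exact pathCap_pathIns_self h0 hs _ _ _ _ (hw.1.symm ▸ hi) hw.2
  cap_ins_succ k i x hi := eq_of_extendZero fun w hw => by
    rw [dyckCap_comp k i (by omega) (dyckIns_comp k _ fun _ _ => rfl) w hw]
    exact pathCap_pathIns_succ ha _ _ _ _ (hw.1.symm ▸ hi) hw.2
  cap_succ_ins k i x hi := eq_of_extendZero fun w hw => by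
    rw [dyckCap_comp k _ hi (dyckIns_comp k _ fun _ _ => rfl) w hw]
    exact pathCap_succ_pathIns ha _ _ _ _ (hw.1.symm ▸ hi) hw.2
  cap_ins_of_le k i j x hij hj := eq_of_extendZero fun w hw => by
    rw [dyckCap_comp (k + 1) i (by omega) (dyckIns_comp (k + 1) _ fun _ _ => rfl) w hw,
      dyckIns_comp k j (dyckCap_comp k i (by omega) fun _ _ => rfl) w hw]
    exact pathCap_pathIns_of_le i j _ _ _ hij
  cap_ins_of_ge k i j x hij hj := eq_of_extendZero fun w hw => by
    rw [dyckCap_comp (k + 1) _ (by omega) (dyckIns_comp (k + 1) _ fun _ _ => rfl) w hw,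
      dyckIns_comp k i (dyckCap_comp k j (by omega) fun _ _ => rfl) w hw]
    exact pathCap_pathIns_of_ge i j _ _ _ hij
  ins_ins k i j x hij hj := eq_of_extendZero fun w hw => by
    rw [dyckIns_comp (k + 1) _ (dyckIns_comp k _ fun _ _ => rfl) w hw,
      dyckIns_comp (k + 1) _ (dyckIns_comp k _ fun _ _ => rfl) w hw]
    exact pathIns_pathIns i j _ _ _ hij

section

variable (ha : ∀ h, a h ≠ 0) {δ : ℝ} (h0 : a 0 = δ) (hs : ∀ h, a (h + 1) + (a h)⁻¹ = δ)

theorem pathModel_vec_self {k : ℕ} {w : List Bool} (hw : IsDyck k w) :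
    (pathModel a ha δ h0 hs).vec k w ⟨w, hw⟩ = 1 := by
  induction k generalizing w with
  | zero => rfl
  | succ k ih =>
    obtain ⟨i, u, hi, hu, rfl⟩ := TLModel.exists_eq_insertPeak hw
    rw [← TLModel.ins_vec _ hu hi]
    refine (pathIns_insertPeak i 0 _ u (hu.1.symm ▸ hi) hu.2).trans ?_
    exact (extendZero_of_mem _ hu).trans (ih hu)

theorem le_of_pathModel_vec_ne_zero {k : ℕ} {w : List Bool} (hw : IsDyck k w)
    (p : {w : List Bool // IsDyck k w}) (hp : (pathModel a ha δ h0 hs).vec k w p ≠ 0) :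
    p.1 ≤ w := by
  induction k generalizing w with
  | zero =>
    rw [List.eq_nil_of_length_eq_zero p.2.1, List.eq_nil_of_length_eq_zero hw.1]
  | succ k ih =>
    obtain ⟨i, u, hi, hu, rfl⟩ := TLModel.exists_eq_insertPeak hw
    rw [← TLModel.ins_vec _ hu hi] at hp
    obtain ⟨v, h1, h2, h3⟩ := exists_of_pathIns_ne_zero i 0 _ _ hp
    by_cases hv : IsDyck k v
    · exact h3.trans (insertPeak_le_insertPeak i v u (hv.1.trans hu.1.symm)
        (ih hu ⟨v, hv⟩ fun e => h1 ((extendZero_of_mem _ hv).trans e)))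
    · exact absurd (extendZero_of_not_mem _ hv) h1

/-- The Gram determinant of the vectors of Dyck words is the product of the norms of paths. -/
theorem det_pathModel_pair (k : ℕ) :
    (Matrix.of fun w u : {w : List Bool // IsDyck k w} =>
      (pathModel a ha δ h0 hs).pair k ((pathModel a ha δ h0 hs).vec k w.1)
        ((pathModel a ha δ h0 hs).vec k u.1)).det =
      ∏ w : {w : List Bool // IsDyck k w}, pathNorm a 0 w.1 := by
  classical
  set M := pathModel a ha δ h0 hs with hM
  let L : Matrix {w : List Bool // IsDyck k w} {w : List Bool // IsDyck k w} ℝ :=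
    Matrix.of fun w p => M.vec k w.1 p
  have hL : L.det = 1 := by
    rw [Matrix.det_of_isLowerTriangular]
    · exact Finset.prod_eq_one fun w _ => pathModel_vec_self ha h0 hs w.2
    · intro w p hwp
      by_contra h
      exact absurd (le_of_pathModel_vec_ne_zero ha h0 hs w.2 p h) (not_le_of_gt hwp)
  have : (Matrix.of fun w u : {w : List Bool // IsDyck k w} =>
      M.pair k (M.vec k w.1) (M.vec k u.1)) =
      L * Matrix.diagonal (fun w : {w : List Bool // IsDyck k w} => pathNorm a 0 w.1) *
        L.transpose := by
    ext w u
    rw [Matrix.mul_apply]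
    simp only [Matrix.mul_diagonal, Matrix.transpose_apply]
    change pathPair a (2 * k) 0 (extendZero (L w)) (extendZero (L u)) = _
    rw [pathPair, ← sum_subtype_eq_sum_ofFn (P := IsDyck k) (fun w hw => hw.1)
      (fun v => pathNorm a 0 v * extendZero (L w) v * extendZero (L u) v)]
    · refine Finset.sum_congr rfl fun p _ => ?_
      rw [extendZero_of_mem _ p.2, extendZero_of_mem _ p.2]
      ring
    · intro v hv hv'
      rw [pathNorm_of_not_ballotFrom _ _ fun h => hv' ⟨hv, h⟩, zero_mul, zero_mul]
  rw [this, Matrix.det_mul, Matrix.det_mul, Matrix.det_transpose, hL, Matrix.det_diagonal]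
  ring

end

end Path

/-! ### The partition model: local computations -/

/-- Cups on functions of words over `Fin n`: in even position, insertion of a free letter; in odd
position, duplication of a letter. -/
noncomputable def colorIns {n : ℕ} (δ : ℝ) : ℕ → (List (Fin n) → ℝ) → List (Fin n) → ℝ
  | 0, f, _ :: w => δ⁻¹ * f w
  | 1, f, a :: b :: w => if a = b then f (b :: w) else 0
  | i + 2, f, a :: w => colorIns δ i (fun u => f (a :: u)) w
  | _, _, _ => 0

/-- Caps on functions of words over `Fin n`: in even position, summation over a letter; in odd
position, restriction to words with a repeated letter. -/
noncomputable def colorCap {n : ℕ} (δ : ℝ) : ℕ → (List (Fin n) → ℝ) → List (Fin n) → ℝ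
  | 0, f, w => ∑ a, f (a :: w)
  | 1, f, a :: w => δ * f (a :: a :: w)
  | i + 2, f, a :: w => colorCap δ i (fun u => f (a :: u)) w
  | _, _, _ => 0

section Color

variable {n : ℕ} {δ : ℝ}

theorem colorIns_mul : ∀ (i : ℕ) (r : ℝ) (f : List (Fin n) → ℝ) (w : List (Fin n)),
    colorIns δ i (fun u => r * f u) w = r * colorIns δ i f w
  | 0, r, f, [] => by simp [colorIns]
  | 0, r, f, a :: w => by simp only [colorIns]; ring
  | 1, r, f, [] => by simp [colorIns]
  | 1, r, f, [a] => by simp [colorIns]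
  | 1, r, f, a :: b :: w => by simp [colorIns]
  | i + 2, r, f, [] => by simp [colorIns]
  | i + 2, r, f, a :: w => by simp [colorIns, colorIns_mul i]

theorem colorIns_sum : ∀ (i : ℕ) (f : Fin n → List (Fin n) → ℝ) (w : List (Fin n)),
    colorIns δ i (fun u => ∑ c, f c u) w = ∑ c, colorIns δ i (f c) w
  | 0, f, [] => by simp [colorIns]
  | 0, f, a :: w => by simp only [colorIns, Finset.mul_sum]
  | 1, f, [] => by simp [colorIns]
  | 1, f, [a] => by simp [colorIns]
  | 1, f, a :: b :: w => by
    simp only [colorIns]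
    split_ifs <;> simp
  | i + 2, f, [] => by simp [colorIns]
  | i + 2, f, a :: w => by simp [colorIns, colorIns_sum i]

theorem colorCap_mul : ∀ (i : ℕ) (r : ℝ) (f : List (Fin n) → ℝ) (w : List (Fin n)),
    colorCap δ i (fun u => r * f u) w = r * colorCap δ i f w
  | 0, r, f, w => by simp only [colorCap, Finset.mul_sum]
  | 1, r, f, [] => by simp [colorCap]
  | 1, r, f, a :: w => by simp only [colorCap]; ring
  | i + 2, r, f, [] => by simp [colorCap]
  | i + 2, r, f, a :: w => by simp [colorCap, colorCap_mul i]

theorem colorIns_zero (i : ℕ) (w : List (Fin n)) : colorIns δ i (fun _ => 0) w = 0 := by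
  simpa using colorIns_mul (δ := δ) i 0 (fun _ => 0) w

theorem colorCap_zero (i : ℕ) (w : List (Fin n)) : colorCap δ i (fun _ => 0) w = 0 := by
  simpa using colorCap_mul (δ := δ) i 0 (fun _ => 0) w

theorem colorIns_congr : ∀ (i : ℕ) (f g : List (Fin n) → ℝ) (w : List (Fin n)),
    (∀ u, u.length + 1 = w.length → f u = g u) → colorIns δ i f w = colorIns δ i g w
  | 0, f, g, [], H => by simp [colorIns]
  | 0, f, g, a :: w, H => by simp only [colorIns]; rw [H w rfl]
  | 1, f, g, [], H => by simp [colorIns]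
  | 1, f, g, [a], H => by simp [colorIns]
  | 1, f, g, a :: b :: w, H => by simp only [colorIns]; rw [H (b :: w) rfl]
  | i + 2, f, g, [], H => by simp [colorIns]
  | i + 2, f, g, a :: w, H => by
    simp only [colorIns]
    exact colorIns_congr i _ _ w fun u hu => H _ (by simpa using hu)

theorem colorCap_congr : ∀ (i : ℕ) (f g : List (Fin n) → ℝ) (w : List (Fin n)),
    (∀ u, u.length = w.length + 1 → f u = g u) → colorCap δ i f w = colorCap δ i g w
  | 0, f, g, w, H => by
    simp only [colorCap]
    exact Finset.sum_congr rfl fun a _ => H _ (by simp)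
  | 1, f, g, [], H => by simp [colorCap]
  | 1, f, g, a :: w, H => by simp only [colorCap]; rw [H (a :: a :: w) rfl]
  | i + 2, f, g, [], H => by simp [colorCap]
  | i + 2, f, g, a :: w, H => by
    simp only [colorCap]
    exact colorCap_congr i _ _ w fun u hu => H _ (by simpa using hu)

theorem colorCap_colorIns_self (hδ : δ ≠ 0) (hn : δ ^ 2 = n) :
    ∀ (i : ℕ) (f : List (Fin n) → ℝ) (w : List (Fin n)), i ≤ 2 * w.length →
      colorCap δ i (colorIns δ i f) w = δ * f w
  | 0, f, w, hi => by
    simp only [colorCap, colorIns, Finset.sum_const, Finset.card_univ, Fintype.card_fin,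
      nsmul_eq_mul, ← hn]
    field_simp
  | 1, f, [], hi => by simp at hi
  | 1, f, a :: w, hi => by simp [colorCap, colorIns]
  | i + 2, f, [], hi => by simp at hi
  | i + 2, f, a :: w, hi => by
    simp only [colorCap, colorIns]
    exact colorCap_colorIns_self hδ hn i _ w (by simp at hi; omega)

theorem colorCap_colorIns_succ (hδ : δ ≠ 0) :
    ∀ (i : ℕ) (f : List (Fin n) → ℝ) (w : List (Fin n)), i + 1 ≤ 2 * w.length →
      colorCap δ i (colorIns δ (i + 1) f) w = f w
  | i, f, [], hi => by simp at hi
  | 0, f, a :: w, hi => by simp [colorCap, colorIns]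
  | 1, f, a :: w, hi => by simp [colorCap, colorIns, hδ]
  | i + 2, f, a :: w, hi => by
    simp only [colorCap]
    exact colorCap_colorIns_succ hδ i _ w (by simp at hi; omega)

theorem colorCap_succ_colorIns (hδ : δ ≠ 0) :
    ∀ (i : ℕ) (f : List (Fin n) → ℝ) (w : List (Fin n)), i + 1 ≤ 2 * w.length →
      colorCap δ (i + 1) (colorIns δ i f) w = f w
  | i, f, [], hi => by simp at hi
  | 0, f, a :: w, hi => by simp [colorCap, colorIns, hδ]
  | 1, f, a :: w, hi => by simp [colorCap, colorIns]
  | i + 2, f, a :: w, hi => by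
    rw [colorCap]
    exact colorCap_succ_colorIns hδ i _ w (by simp at hi; omega)

theorem colorCap_colorIns_of_le :
    ∀ (i j : ℕ) (f : List (Fin n) → ℝ) (w : List (Fin n)), i ≤ j →
      colorCap δ i (colorIns δ (j + 2) f) w = colorIns δ j (colorCap δ i f) w
  | 0, j, f, w, _ => (colorIns_sum j (fun c u => f (c :: u)) w).symm
  | 1, 0, f, w, h => by simp at h
  | 1, 1, f, [], _ => by simp [colorCap, colorIns]
  | 1, 1, f, [a], _ => by simp [colorCap, colorIns]
  | 1, 1, f, a :: b :: w, _ => by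
    simp only [colorCap, colorIns]
    split_ifs with h
    · rw [h]
    · simp
  | 1, j + 2, f, [], _ => by simp [colorCap, colorIns]
  | 1, j + 2, f, a :: w, _ => by
    simp only [colorCap, colorIns]
    exact (colorIns_mul ..).symm
  | i + 2, 0, f, w, h => by simp at h
  | i + 2, 1, f, w, h => by omega
  | i + 2, j + 2, f, [], h => by simp [colorCap, colorIns]
  | i + 2, j + 2, f, a :: w, h => by
    rw [colorCap, colorIns]
    exact colorCap_colorIns_of_le i j _ w (by omega)

theorem colorCap_colorIns_of_ge :
    ∀ (i j : ℕ) (f : List (Fin n) → ℝ) (w : List (Fin n)), i ≤ j →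
      colorCap δ (j + 2) (colorIns δ i f) w = colorIns δ i (colorCap δ j f) w
  | 0, j, f, [], _ => by simp [colorCap, colorIns]
  | 0, j, f, a :: w, _ => colorCap_mul ..
  | 1, 0, f, w, h => by simp at h
  | 1, 1, f, [], _ => by simp [colorCap, colorIns]
  | 1, 1, f, [a], _ => by simp [colorCap, colorIns]
  | 1, 1, f, a :: b :: w, _ => by simp [colorCap, colorIns]
  | 1, j + 2, f, [], _ => by simp [colorCap, colorIns]
  | 1, j + 2, f, [a], _ => by simp [colorCap, colorIns]
  | 1, j + 2, f, a :: b :: w, _ => by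
    simp only [colorCap, colorIns]
    split_ifs with h
    · rfl
    · exact colorCap_zero ..
  | i + 2, 0, f, w, h => by simp at h
  | i + 2, 1, f, w, h => by omega
  | i + 2, j + 2, f, [], h => by simp [colorCap, colorIns]
  | i + 2, j + 2, f, a :: w, h => by
    rw [colorCap, colorIns]
    exact colorCap_colorIns_of_ge i j _ w (by omega)

theorem colorIns_colorIns :
    ∀ (i j : ℕ) (f : List (Fin n) → ℝ) (w : List (Fin n)), i ≤ j →
      colorIns δ i (colorIns δ j f) w = colorIns δ (j + 2) (colorIns δ i f) w
  | 0, j, f, [], _ => by simp [colorIns]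
  | 0, j, f, a :: w, _ => (colorIns_mul ..).symm
  | 1, 0, f, w, h => by simp at h
  | 1, 1, f, [], _ => by simp [colorIns]
  | 1, 1, f, [a], _ => by simp [colorIns]
  | 1, 1, f, [a, b], _ => by simp [colorIns]
  | 1, 1, f, a :: b :: c :: w, _ => by
    simp only [colorIns]
    by_cases h : b = c
    · simp [h]
    · simp [h]
  | 1, j + 2, f, [], _ => by simp [colorIns]
  | 1, j + 2, f, [a], _ => by simp [colorIns]
  | 1, j + 2, f, a :: b :: w, _ => by
    simp only [colorIns]
    split_ifs with h
    · rfl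
    · exact (colorIns_zero ..).symm
  | i + 2, 0, f, w, h => by simp at h
  | i + 2, 1, f, w, h => by omega
  | i + 2, j + 2, f, [], h => by simp [colorIns]
  | i + 2, j + 2, f, a :: w, h => by
    rw [colorIns, colorIns]
    exact colorIns_colorIns i j _ w (by omega)

/-- The standard bilinear form on functions of words of length `N` over `Fin n`. -/
noncomputable def colorPair (N : ℕ) (f g : List (Fin n) → ℝ) : ℝ :=
  ∑ x : Fin N → Fin n, f (List.ofFn x) * g (List.ofFn x)

theorem colorPair_succ (N : ℕ) (f g : List (Fin n) → ℝ) : colorPair (N + 1) f g =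
    ∑ a, colorPair N (fun u => f (a :: u)) (fun u => g (a :: u)) :=
  sum_ofFn_succ N fun w => f w * g w

theorem colorPair_congr {N : ℕ} {f g f' g' : List (Fin n) → ℝ}
    (hf : ∀ u, u.length = N → f u = f' u) (hg : ∀ u, u.length = N → g u = g' u) :
    colorPair N f g = colorPair N f' g' :=
  Finset.sum_congr rfl fun x _ => by rw [hf _ (by simp), hg _ (by simp)]

theorem colorPair_colorIns (hδ : δ ≠ 0) : ∀ (i N : ℕ) (f g : List (Fin n) → ℝ), i ≤ 2 * N →
    colorPair (N + 1) (colorIns δ i f) g = δ⁻¹ * colorPair N f (colorCap δ i g)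
  | 0, N, f, g, _ => by
    rw [colorPair_succ]
    simp only [colorPair, colorIns, colorCap, Finset.mul_sum]
    rw [Finset.sum_comm]
    exact Finset.sum_congr rfl fun x _ => Finset.sum_congr rfl fun a _ => by ring
  | 1, 0, f, g, h => by simp at h
  | 1, N + 1, f, g, _ => by
    rw [colorPair_succ, colorPair_succ, Finset.mul_sum]
    refine Finset.sum_congr rfl fun a _ => ?_
    rw [colorPair_succ, Finset.sum_eq_single a]
    · simp only [colorPair, colorIns, colorCap, Finset.mul_sum, if_true]
      exact Finset.sum_congr rfl fun x _ => by field_simp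
    · intro b _ hb
      simp [colorPair, colorIns, Ne.symm hb]
    · simp
  | i + 2, 0, f, g, h => by simp at h
  | i + 2, N + 1, f, g, h => by
    rw [colorPair_succ, colorPair_succ, Finset.mul_sum]
    refine Finset.sum_congr rfl fun a _ => ?_
    simp only [colorIns, colorCap]
    exact colorPair_colorIns hδ i N _ _ (by omega)

theorem extendZero_of_length {k : ℕ} (x : {w : List (Fin n) // w.length = k} → ℝ)
    {w : List (Fin n)} (hw : w.length = k) : extendZero x w = x ⟨w, hw⟩ :=
  extendZero_of_mem (P := fun w : List (Fin n) => w.length = k) x hw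

theorem eq_of_extendZero_length {k : ℕ} {x y : {w : List (Fin n) // w.length = k} → ℝ}
    (h : ∀ w : List (Fin n), w.length = k → extendZero x w = extendZero y w) : x = y := by
  funext w
  have := h w.1 w.2
  rwa [extendZero_of_length _ w.2, extendZero_of_length _ w.2] at this

/-- The operation `colorIns` on functions of words of fixed length. -/
noncomputable def wordIns (δ : ℝ) (k i : ℕ) (x : {w : List (Fin n) // w.length = k} → ℝ)
    (w : {w : List (Fin n) // w.length = k + 1}) : ℝ :=
  colorIns δ i (extendZero x) w.1

/-- The operation `colorCap` on functions of words of fixed length. -/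
noncomputable def wordCap (δ : ℝ) (k i : ℕ) (x : {w : List (Fin n) // w.length = k + 1} → ℝ)
    (w : {w : List (Fin n) // w.length = k}) : ℝ :=
  colorCap δ i (extendZero x) w.1

theorem wordIns_comp (k i : ℕ) {x : {w : List (Fin n) // w.length = k} → ℝ}
    {f : List (Fin n) → ℝ} (hf : ∀ w, w.length = k → extendZero x w = f w) (w : List (Fin n))
    (hw : w.length = k + 1) : extendZero (wordIns δ k i x) w = colorIns δ i f w := by
  rw [extendZero_of_length _ hw]
  refine colorIns_congr _ _ _ _ fun u hu => hf _ ?_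
  dsimp only at hu
  omega

theorem wordCap_comp (k i : ℕ) {x : {w : List (Fin n) // w.length = k + 1} → ℝ}
    {f : List (Fin n) → ℝ} (hf : ∀ w, w.length = k + 1 → extendZero x w = f w)
    (w : List (Fin n)) (hw : w.length = k) :
    extendZero (wordCap δ k i x) w = colorCap δ i f w := by
  rw [extendZero_of_length _ hw]
  refine colorCap_congr _ _ _ _ fun u hu => hf _ ?_
  dsimp only at hu
  omega

variable (n) in
/-- The model of the Temperley-Lieb calculus on functions of words over `Fin n`. -/
noncomputable def colorModel (δ : ℝ) (hδ : δ ≠ 0) (hn : δ ^ 2 = n) : TLModel δ where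
  c := δ⁻¹
  A k := {w : List (Fin n) // w.length = k}
  ins := wordIns δ
  cap := wordCap δ
  one _ := 1
  pair k x y := colorPair k (extendZero x) (extendZero y)
  ins_smul k i r x := by
    funext w
    simp only [wordIns, extendZero_smul, colorIns_mul, Pi.smul_apply, smul_eq_mul]
  pair_smul k r x y := by
    simp only [extendZero_smul, colorPair, Finset.mul_sum]
    exact Finset.sum_congr rfl fun x _ => by ring
  pair_one := by
    have h : ([] : List (Fin n)).length = 0 := rfl
    simp [colorPair, extendZero_of_length _ h]
  pair_ins k i x y hi := by
    rw [colorPair_congr (f' := colorIns δ i (extendZero x)) (g' := extendZero y)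
      (wordIns_comp k i (fun _ _ => rfl)) (fun _ _ => rfl),
      colorPair_congr (f := extendZero x) (f' := extendZero x)
        (g' := colorCap δ i (extendZero y)) (fun _ _ => rfl)
        (wordCap_comp k i (fun _ _ => rfl))]
    exact colorPair_colorIns hδ i k _ _ hi
  cap_ins_self k i x hi := eq_of_extendZero_length fun w hw => by
    rw [wordCap_comp k i (wordIns_comp k i fun _ _ => rfl) w hw, extendZero_smul]
    exact colorCap_colorIns_self hδ hn _ _ _ (hw.symm ▸ hi)
  cap_ins_succ k i x hi := eq_of_extendZero_length fun w hw => by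
    rw [wordCap_comp k i (wordIns_comp k _ fun _ _ => rfl) w hw]
    exact colorCap_colorIns_succ hδ _ _ _ (hw.symm ▸ hi)
  cap_succ_ins k i x hi := eq_of_extendZero_length fun w hw => by
    rw [wordCap_comp k _ (wordIns_comp k _ fun _ _ => rfl) w hw]
    exact colorCap_succ_colorIns hδ _ _ _ (hw.symm ▸ hi)
  cap_ins_of_le k i j x hij hj := eq_of_extendZero_length fun w hw => by
    rw [wordCap_comp (k + 1) i (wordIns_comp (k + 1) _ fun _ _ => rfl) w hw,
      wordIns_comp k j (wordCap_comp k i fun _ _ => rfl) w hw]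
    exact colorCap_colorIns_of_le i j _ _ hij
  cap_ins_of_ge k i j x hij hj := eq_of_extendZero_length fun w hw => by
    rw [wordCap_comp (k + 1) _ (wordIns_comp (k + 1) _ fun _ _ => rfl) w hw,
      wordIns_comp k i (wordCap_comp k j fun _ _ => rfl) w hw]
    exact colorCap_colorIns_of_ge i j _ _ hij
  ins_ins k i j x hij hj := eq_of_extendZero_length fun w hw => by
    rw [wordIns_comp (k + 1) _ (wordIns_comp k _ fun _ _ => rfl) w hw,
      wordIns_comp (k + 1) _ (wordIns_comp k _ fun _ _ => rfl) w hw]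
    exact colorIns_colorIns i j _ _ hij

end Color

/-! ### Noncrossing partitions and words -/

section Partition

variable {n : ℕ} {δ : ℝ}

open Classical in
/-- The indicator function of the words that are constant on the blocks of a partition. -/
noncomputable def blockIndicator {k : ℕ} (π : Setoid (Fin k)) (w : List (Fin n)) : ℝ :=
  if ∀ a b : Fin k, π a b → w[(a : ℕ)]? = w[(b : ℕ)]? then 1 else 0

/-- The restriction of `blockIndicator` to words of length `k`. -/
noncomputable def blockVec (n : ℕ) {k : ℕ} (π : Setoid (Fin k))
    (w : {w : List (Fin n) // w.length = k}) : ℝ := blockIndicator π w.1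

theorem colorIns_two_mul : ∀ (i : ℕ) (f : List (Fin n) → ℝ) (w : List (Fin n)), i < w.length →
    colorIns δ (2 * i) f w = δ⁻¹ * f (w.eraseIdx i)
  | i, f, [], h => by simp at h
  | 0, f, a :: w, _ => by simp [colorIns]
  | i + 1, f, a :: w, h => by
    rw [show 2 * (i + 1) = 2 * i + 2 by ring, colorIns,
      colorIns_two_mul i _ w (by simpa using h), List.eraseIdx_cons_succ]

theorem colorIns_two_mul_add_one : ∀ (i : ℕ) (f : List (Fin n) → ℝ) (w : List (Fin n)),
    i + 1 < w.length →
    colorIns δ (2 * i + 1) f w = if w[i]? = w[i + 1]? then f (w.eraseIdx i) else 0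
  | i, f, [], h => by simp at h
  | 0, f, [a], h => by simp at h
  | 0, f, a :: b :: w, _ => by simp [colorIns]
  | i + 1, f, a :: w, h => by
    rw [show 2 * (i + 1) + 1 = 2 * i + 1 + 2 by ring, colorIns,
      colorIns_two_mul_add_one i _ w (by simpa using h), List.eraseIdx_cons_succ]
    simp only [List.getElem?_cons_succ]

theorem getElem?_eraseIdx_eq_succAbove {k : ℕ} (i : Fin (k + 1)) (a : Fin k) (w : List (Fin n)) :
    (w.eraseIdx i)[(a : ℕ)]? = w[(i.succAbove a : ℕ)]? := by
  rw [List.getElem?_eraseIdx]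
  by_cases h : (a : ℕ) < i
  · rw [Fin.succAbove_of_castSucc_lt _ _ (by simpa [Fin.lt_def] using h)]
    simp [h]
  · rw [Fin.succAbove_of_le_castSucc _ _ (by simpa [Fin.le_def] using h)]
    simp [h]

theorem blockIndicator_of_singleton {k : ℕ} {π : Setoid (Fin (k + 1))} {i : Fin (k + 1)}
    (hi : ∀ b, π i b → b = i) (w : List (Fin n)) :
    blockIndicator π w = blockIndicator (Setoid.comap i.succAbove π) (w.eraseIdx i) := by
  unfold blockIndicator
  congr 1
  simp only [getElem?_eraseIdx_eq_succAbove, Setoid.comap_rel, eq_iff_iff]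
  refine ⟨fun H a b h => H _ _ h, fun H a b h => ?_⟩
  rcases Fin.eq_self_or_eq_succAbove i a with rfl | ⟨a, rfl⟩
  · rw [hi b h]
  · rcases Fin.eq_self_or_eq_succAbove i b with rfl | ⟨b, rfl⟩
    · rw [hi _ (Setoid.symm' _ h)]
    · exact H a b h

theorem blockIndicator_of_adjacent {k : ℕ} {π : Setoid (Fin (k + 1))} {i : Fin k}
    (hi : π i.castSucc i.succ) (w : List (Fin n)) :
    blockIndicator π w = if w[(i : ℕ)]? = w[(i : ℕ) + 1]? then
      blockIndicator (Setoid.comap i.castSucc.succAbove π) (w.eraseIdx i) else 0 := by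
  unfold blockIndicator
  have erase : ∀ a : Fin k, (w.eraseIdx i)[(a : ℕ)]? = w[(i.castSucc.succAbove a : ℕ)]? :=
    fun a => getElem?_eraseIdx_eq_succAbove i.castSucc a w
  rw [← ite_and]
  congr 1
  simp only [erase, Setoid.comap_rel, eq_iff_iff]
  refine ⟨fun H => ⟨by simpa using H _ _ hi, fun a b h => H _ _ h⟩, fun ⟨H1, H⟩ => ?_⟩
  have key : ∀ a, ∃ a', π a (i.castSucc.succAbove a') ∧
      w[(a : ℕ)]? = w[(i.castSucc.succAbove a' : ℕ)]? := by
    intro a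
    rcases Fin.eq_self_or_eq_succAbove i.castSucc a with rfl | ⟨a, rfl⟩
    · exact ⟨i, by simpa using hi, by simpa using H1⟩
    · exact ⟨a, Setoid.refl' _ _, rfl⟩
  intro a b h
  obtain ⟨a', ha, ha'⟩ := key a
  obtain ⟨b', hb, hb'⟩ := key b
  rw [ha', hb']
  exact H _ _ (Setoid.trans' π (Setoid.symm' π ha) (Setoid.trans' π h hb))

theorem wordIns_blockVec_of_singleton {k : ℕ} {π : Setoid (Fin (k + 1))} {i : Fin (k + 1)}
    (hi : ∀ b, π i b → b = i) :
    wordIns δ k (2 * i) (blockVec n (Setoid.comap i.succAbove π)) = δ⁻¹ • blockVec n π := by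
  funext w
  have h := w.2
  rw [wordIns, colorIns_two_mul _ _ _ (h.symm ▸ i.2), Pi.smul_apply, blockVec,
    blockIndicator_of_singleton hi, smul_eq_mul, extendZero_of_length]
  · rfl
  · rw [List.length_eraseIdx_of_lt (h.symm ▸ i.2), h]
    rfl

theorem wordIns_blockVec_of_adjacent {k : ℕ} {π : Setoid (Fin (k + 1))} {i : Fin k}
    (hi : π i.castSucc i.succ) :
    wordIns δ k (2 * i + 1) (blockVec n (Setoid.comap i.castSucc.succAbove π)) =
      blockVec n π := by
  funext w
  have h := w.2
  rw [wordIns, colorIns_two_mul_add_one _ _ _ (by omega), blockVec,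
    blockIndicator_of_adjacent hi, extendZero_of_length]
  · rfl
  · rw [List.length_eraseIdx_of_lt (by omega), h]
    rfl

theorem IsNoncrossing.comap_strictMono {k l : ℕ} {π : Setoid (Fin l)} (hπ : IsNoncrossing π)
    {f : Fin k → Fin l} (hf : StrictMono f) : IsNoncrossing (Setoid.comap f π) :=
  fun _ _ _ _ hab hbc hcd h1 h2 => hπ _ _ _ _ (hf hab) (hf hbc) (hf hcd) h1 h2

theorem IsNoncrossing.comap_monotone {k l : ℕ} {π : Setoid (Fin l)} (hπ : IsNoncrossing π)
    {f : Fin k → Fin l} (hf : Monotone f) : IsNoncrossing (Setoid.comap f π) := by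
  intro a b c d hab hbc hcd h1 h2
  simp only [Setoid.comap_rel] at *
  rcases (hf hab.le).eq_or_lt with h | h
  · rw [h]
  rcases (hf hbc.le).eq_or_lt with h' | h'
  · rw [h']; exact h1
  rcases (hf hcd.le).eq_or_lt with h'' | h''
  · rw [h''] at h1
    exact Setoid.trans' _ h1 (Setoid.symm' _ h2)
  exact hπ _ _ _ _ h h' h'' h1 h2

/-- Insertion of a singleton block at position `i`. -/
def insertSingleton {k : ℕ} (i : Fin (k + 1)) (π : Setoid (Fin k)) : Setoid (Fin (k + 1)) :=
  Setoid.ker (i.insertNth (α := fun _ => Option (Quotient π)) none fun a => some (Quotient.mk π a))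

theorem insertSingleton_rel {k : ℕ} {i a b : Fin (k + 1)} {π : Setoid (Fin k)} :
    insertSingleton i π a b ↔
      i.insertNth (α := fun _ => Option (Quotient π)) none (fun a => some (Quotient.mk π a)) a =
        i.insertNth (α := fun _ => Option (Quotient π)) none (fun a => some (Quotient.mk π a)) b :=
  Iff.rfl

theorem comap_insertSingleton {k : ℕ} (i : Fin (k + 1)) (π : Setoid (Fin k)) :
    Setoid.comap i.succAbove (insertSingleton i π) = π := by
  ext a b
  simp [insertSingleton_rel, Setoid.comap_rel, Quotient.eq]

theorem eq_of_insertSingleton {k : ℕ} {i b : Fin (k + 1)} {π : Setoid (Fin k)}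
    (h : insertSingleton i π i b) : b = i := by
  rcases Fin.eq_self_or_eq_succAbove i b with rfl | ⟨b, rfl⟩
  · rfl
  · simp [insertSingleton_rel] at h

theorem IsNoncrossing.insertSingleton {k : ℕ} {π : Setoid (Fin k)} (hπ : IsNoncrossing π)
    (i : Fin (k + 1)) : IsNoncrossing (insertSingleton i π) := by
  intro a b c d hab hbc hcd h1 h2
  have aux : ∀ x y, x < y → _root_.insertSingleton i π x y → x ≠ i ∧ y ≠ i := by
    refine fun x y hxy h => ⟨?_, ?_⟩
    · rintro rfl
      exact hxy.ne' (eq_of_insertSingleton h)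
    · rintro rfl
      exact hxy.ne (eq_of_insertSingleton (Setoid.symm' _ h))
  obtain ⟨ha, hc⟩ := aux _ _ (hab.trans hbc) h1
  obtain ⟨hb, hd⟩ := aux _ _ (hbc.trans hcd) h2
  obtain ⟨a, rfl⟩ := Fin.exists_succAbove_eq ha
  obtain ⟨b, rfl⟩ := Fin.exists_succAbove_eq hb
  obtain ⟨c, rfl⟩ := Fin.exists_succAbove_eq hc
  obtain ⟨d, rfl⟩ := Fin.exists_succAbove_eq hd
  rw [← Setoid.comap_rel, comap_insertSingleton] at *
  rw [Fin.succAbove_lt_succAbove_iff] at hab hbc hcd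
  exact hπ _ _ _ _ hab hbc hcd h1 h2

theorem comap_succAbove_comap_predAbove {k : ℕ} (i : Fin k) (π : Setoid (Fin k)) :
    Setoid.comap i.castSucc.succAbove (Setoid.comap i.predAbove π) = π := by
  ext a b
  simp [Setoid.comap_rel]

/-- A nonempty noncrossing partition has a singleton block or two adjacent points in a block. -/
theorem IsNoncrossing.exists_singleton_or_adjacent {k : ℕ} {π : Setoid (Fin (k + 1))}
    (hπ : IsNoncrossing π) :
    (∃ i, ∀ b, π i b → b = i) ∨ ∃ i : Fin k, π i.castSucc i.succ := by
  by_contra! H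
  obtain ⟨H1, H2⟩ := H
  have adj : ∀ a b : Fin (k + 1), (b : ℕ) = a + 1 → ¬ π a b := by
    intro a b hab h
    have hk : (a : ℕ) < k := by have := b.2; omega
    refine H2 ⟨a, hk⟩ ?_
    have : (⟨a, hk⟩ : Fin k).succ = b := Fin.ext hab.symm
    rw [this]
    exact h
  have main : ∀ (m : ℕ) (a b : Fin (k + 1)), (b : ℕ) = a + m → 0 < m → ¬ π a b := by
    intro m
    induction m using Nat.strong_induction_on with
    | _ m ih =>
      intro a b hab hm h
      rcases Nat.lt_or_ge 1 m with h1 | h1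
      · have hb := b.2
        obtain ⟨c, hc⟩ : ∃ c : Fin (k + 1), (c : ℕ) = a + 1 := ⟨⟨a + 1, by omega⟩, rfl⟩
        have hac := adj a c hc
        obtain ⟨d, hcd, hne⟩ := H1 c
        rcases lt_trichotomy d a with hd | rfl | hd
        · refine hac (Setoid.trans' _ (Setoid.symm' _ (hπ d a c b hd ?_ ?_ (Setoid.symm' _ hcd) h))
            (Setoid.symm' _ hcd)) <;> rw [Fin.lt_def] <;> omega
        · exact hac (Setoid.symm' _ hcd)
        · have hcd' : (c : ℕ) < d := by
            rw [Fin.lt_def] at hd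
            have : (d : ℕ) ≠ c := fun e => hne (Fin.ext e)
            omega
          rcases lt_trichotomy d b with hd' | rfl | hd'
          · rw [Fin.lt_def] at hd'
            exact ih (d - c) (by omega) c d (by omega) (by omega) hcd
          · exact hac (Setoid.trans' _ h (Setoid.symm' _ hcd))
          · refine hac (hπ a c b d ?_ ?_ hd' h hcd) <;> rw [Fin.lt_def] <;> omega
      · exact adj a b (by omega) h
  obtain ⟨b, hb, hne⟩ := H1 0
  refine main b 0 b (by simp) ?_ hb
  have : (b : ℕ) ≠ 0 := fun e => hne (Fin.ext e)
  omega

variable (hδ : δ ≠ 0) (hn : δ ^ 2 = n)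

theorem colorModel_vec_insertPeak {k i : ℕ} {w : List Bool} (hw : IsDyck k w) (hi : i ≤ 2 * k)
    {π : Setoid (Fin k)} {r : ℝ} (h : (colorModel n δ hδ hn).vec k w = r • blockVec n π) :
    (colorModel n δ hδ hn).vec (k + 1) (insertPeak i w) =
      r • wordIns δ k i (blockVec n π) := by
  rw [← TLModel.ins_vec _ hw hi, h]
  exact (colorModel n δ hδ hn).ins_smul k i r _

theorem exists_word_of_isNoncrossing (hp : 0 < δ) {k : ℕ} {π : Setoid (Fin k)}
    (hπ : IsNoncrossing π) : ∃ w, IsDyck k w ∧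
      ∃ r : ℝ, 0 < r ∧ (colorModel n δ hδ hn).vec k w = r • blockVec n π := by
  induction k with
  | zero =>
    refine ⟨[], ⟨rfl, rfl⟩, 1, one_pos, ?_⟩
    funext w
    simp [blockVec, blockIndicator, TLModel.vec, colorModel]
  | succ k ih =>
    rcases hπ.exists_singleton_or_adjacent with ⟨i, hi⟩ | ⟨i, hi⟩
    · obtain ⟨w, hw, r, hr, h⟩ := ih (hπ.comap_strictMono (Fin.strictMono_succAbove i))
      refine ⟨insertPeak (2 * i) w, hw.insertPeak (by omega), r * δ⁻¹, by positivity, ?_⟩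
      rw [colorModel_vec_insertPeak hδ hn hw (by omega) h, wordIns_blockVec_of_singleton hi,
        smul_smul]
    · obtain ⟨w, hw, r, hr, h⟩ := ih (hπ.comap_strictMono (Fin.strictMono_succAbove i.castSucc))
      refine ⟨insertPeak (2 * i + 1) w, hw.insertPeak (by omega), r, hr, ?_⟩
      rw [colorModel_vec_insertPeak hδ hn hw (by omega) h, wordIns_blockVec_of_adjacent hi]

theorem exists_isNoncrossing_of_word (hp : 0 < δ) {k : ℕ} {w : List Bool} (hw : IsDyck k w) :
    ∃ π : Setoid (Fin k), IsNoncrossing π ∧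
      ∃ r : ℝ, 0 < r ∧ (colorModel n δ hδ hn).vec k w = r • blockVec n π := by
  induction k generalizing w with
  | zero =>
    refine ⟨⊥, fun a => a.elim0, 1, one_pos, ?_⟩
    funext w
    simp [blockVec, blockIndicator, TLModel.vec, colorModel]
  | succ k ih =>
    obtain ⟨j, u, hj, hu, rfl⟩ := TLModel.exists_eq_insertPeak hw
    obtain ⟨π, hπ, r, hr, h⟩ := ih hu
    obtain ⟨i, rfl | rfl⟩ := Nat.even_or_odd' j
    · obtain ⟨i, rfl⟩ : ∃ i' : Fin (k + 1), (i' : ℕ) = i := ⟨⟨i, by omega⟩, rfl⟩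
      refine ⟨_, hπ.insertSingleton i, r * δ⁻¹, by positivity, ?_⟩
      rw [colorModel_vec_insertPeak hδ hn hu hj h, ← smul_smul,
        ← wordIns_blockVec_of_singleton fun b => eq_of_insertSingleton, comap_insertSingleton]
    · obtain ⟨i, rfl⟩ : ∃ i' : Fin k, (i' : ℕ) = i := ⟨⟨i, by omega⟩, rfl⟩
      refine ⟨_, hπ.comap_monotone (Fin.predAbove_right_monotone i), r, hr, ?_⟩
      rw [colorModel_vec_insertPeak hδ hn hu hj h, ← wordIns_blockVec_of_adjacent,
        comap_succAbove_comap_predAbove]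
      simp [Setoid.comap_rel]

open Classical in
theorem blockIndicator_ofFn {k : ℕ} (π : Setoid (Fin k)) (x : Fin k → Fin n) :
    blockIndicator π (List.ofFn x) = if π ≤ Setoid.ker x then 1 else 0 := by
  unfold blockIndicator
  congr 1
  simp [Setoid.le_def, Setoid.ker_def]

theorem colorPair_blockVec {k : ℕ} (π σ : Setoid (Fin k)) :
    colorPair k (extendZero (blockVec n π)) (extendZero (blockVec n σ)) =
      (n : ℝ) ^ blockCount (π ⊔ σ) := by
  classical
  have h1 : ∀ x : Fin k → Fin n, extendZero (blockVec n π) (List.ofFn x) *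
      extendZero (blockVec n σ) (List.ofFn x) = if π ⊔ σ ≤ Setoid.ker x then 1 else 0 := by
    intro x
    rw [extendZero_of_length _ (List.length_ofFn), extendZero_of_length _ (List.length_ofFn)]
    simp only [blockVec, blockIndicator_ofFn, sup_le_iff]
    split_ifs <;> simp_all
  simp only [colorPair, h1]
  rw [Finset.sum_boole, ← Fintype.card_subtype, ← Nat.card_eq_fintype_card,
    Nat.card_congr (Setoid.liftEquiv (β := Fin n) (π ⊔ σ)), Nat.card_fun, blockCount]
  simp

theorem le_of_blockVec_eq_smul (h2 : 2 ≤ n) {k : ℕ} {π σ : Setoid (Fin k)} {r : ℝ} (hr : r ≠ 0)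
    (h : blockVec n π = r • blockVec n σ) : π ≤ σ := by
  classical
  intro a b hab
  let x : Fin k → Fin n := fun c => if σ a c then ⟨0, by omega⟩ else ⟨1, by omega⟩
  have hx : σ ≤ Setoid.ker x := by
    intro c d hcd
    have : σ a c ↔ σ a d :=
      ⟨fun h => Setoid.trans' _ h hcd, fun h => Setoid.trans' _ h (Setoid.symm' _ hcd)⟩
    simp [Setoid.ker_def, x, this]
  have h3 := congrFun h ⟨List.ofFn x, List.length_ofFn⟩
  simp only [blockVec, Pi.smul_apply, blockIndicator_ofFn, hx, if_true, smul_eq_mul,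
    mul_one] at h3
  have h4 : π ≤ Setoid.ker x := by
    by_contra h5
    rw [if_neg h5] at h3
    exact hr h3.symm
  have h5 : x a = x b := h4 hab
  by_contra h6
  simp [x, h6] at h5

theorem eq_of_blockVec_eq_smul (h2 : 2 ≤ n) {k : ℕ} {π σ : Setoid (Fin k)} {r : ℝ} (hr : r ≠ 0)
    (h : blockVec n π = r • blockVec n σ) : π = σ :=
  le_antisymm (le_of_blockVec_eq_smul h2 hr h)
    (le_of_blockVec_eq_smul h2 (inv_ne_zero hr) (by rw [h, smul_smul, inv_mul_cancel₀ hr, one_smul]))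

end Partition

/-! ### The Gram determinant for natural numbers -/

section Gram

variable {n : ℕ} {δ : ℝ} {a : ℕ → ℝ}

theorem sq_mul_pow_blockCount (hδ : δ ≠ 0) (hn : δ ^ 2 = n) {k : ℕ} {w : List Bool}
    (hw : IsDyck k w) {π : Setoid (Fin k)} {r : ℝ}
    (h : (colorModel n δ hδ hn).vec k w = r • blockVec n π) :
    r ^ 2 * δ ^ (2 * blockCount π) = 1 := by
  have h1 := TLModel.pair_vec_self (colorModel n δ hδ hn) hw
  rw [h, show (colorModel n δ hδ hn).c = δ⁻¹ from rfl, inv_mul_cancel₀ hδ, one_pow] at h1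
  have h2 : colorPair k (extendZero (r • blockVec n π)) (extendZero (r • blockVec n π)) = 1 := h1
  rw [extendZero_smul] at h2
  have h3 := colorPair_blockVec (n := n) π π
  rw [sup_idem] at h3
  rw [pow_mul, hn, ← h3, ← h2]
  simp only [colorPair, Finset.mul_sum]
  exact Finset.sum_congr rfl fun x _ => by ring

theorem pathModel_pair_vec (hδ : δ ≠ 0) (hn : δ ^ 2 = n) (ha : ∀ h, a h ≠ 0) (h0 : a 0 = δ)
    (hs : ∀ h, a (h + 1) + (a h)⁻¹ = δ) {k : ℕ} {w u : List Bool} (hw : IsDyck k w)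
    (hu : IsDyck k u) :
    (pathModel a ha δ h0 hs).pair k ((pathModel a ha δ h0 hs).vec k w)
      ((pathModel a ha δ h0 hs).vec k u) =
      δ ^ k * (colorModel n δ hδ hn).pair k ((colorModel n δ hδ hn).vec k w)
        ((colorModel n δ hδ hn).vec k u) := by
  obtain ⟨e, he⟩ := TLModel.exists_pair_vec δ hw hu
  rw [he, he, show (colorModel n δ hδ hn).c = δ⁻¹ from rfl,
    show (pathModel a ha δ h0 hs).c = 1 from rfl, one_pow, one_mul, inv_pow,
    mul_inv_cancel_left₀ (pow_ne_zero k hδ)]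

theorem det_gramMatrix_natCast (h2 : 2 ≤ n) (hδ : 0 < δ) (hn : δ ^ 2 = n) (ha : ∀ h, a h ≠ 0)
    (h0 : a 0 = δ) (hs : ∀ h, a (h + 1) + (a h)⁻¹ = δ) (k : ℕ) :
    (gramMatrix k (n : ℝ)).det =
      δ ^ gramExponent k * ∏ w : {w : List Bool // IsDyck k w}, pathNorm a 0 w.1 := by
  classical
  choose φ hφ r hr hv using fun π : NCPartition k =>
    exists_word_of_isNoncrossing hδ.ne' hn hδ π.2
  set M := colorModel n δ hδ.ne' hn with hM
  set L := pathModel a ha δ h0 hs with hL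
  let Φ : NCPartition k → {w : List Bool // IsDyck k w} := fun π => ⟨φ π, hφ π⟩
  have hinj : Function.Injective Φ := by
    intro π σ h
    have h1 : φ π = φ σ := congrArg Subtype.val h
    refine Subtype.ext (eq_of_blockVec_eq_smul h2 (r := (r π)⁻¹ * r σ)
      (mul_ne_zero (inv_ne_zero (hr π).ne') (hr σ).ne') ?_)
    rw [← smul_smul]
    have h3 := hv π
    rw [h1, hv σ] at h3
    rw [h3, smul_smul, inv_mul_cancel₀ (hr π).ne', one_smul]
  have hdet := det_pathModel_pair ha h0 hs k
  have hne : ∏ w : {w : List Bool // IsDyck k w}, pathNorm a 0 w.1 ≠ 0 :=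
    Finset.prod_ne_zero_iff.2 fun w _ => pathNorm_ne_zero ha 0 w.1 w.2.2
  have hsurj : Function.Surjective Φ := by
    intro w
    obtain ⟨π, hπ, s, hs0, hs1⟩ := exists_isNoncrossing_of_word hδ.ne' hn hδ w.2
    refine ⟨⟨π, hπ⟩, ?_⟩
    by_contra hw
    have e1 := sq_mul_pow_blockCount hδ.ne' hn w.2 hs1
    have e2 := sq_mul_pow_blockCount hδ.ne' hn (hφ ⟨π, hπ⟩) (hv ⟨π, hπ⟩)
    have e3 : r ⟨π, hπ⟩ ^ 2 = s ^ 2 :=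
      mul_right_cancel₀ (pow_ne_zero _ hδ.ne') (e2.trans e1.symm)
    have e4 : r ⟨π, hπ⟩ = s := (pow_left_inj₀ (hr _).le hs0.le two_ne_zero).1 e3
    have e5 : M.vec k (φ ⟨π, hπ⟩) = M.vec k w.1 := by rw [hv, e4, hs1]
    refine hne (hdet.symm.trans (Matrix.det_zero_of_row_eq hw ?_))
    funext u
    simp only [Matrix.of_apply, Φ]
    rw [pathModel_pair_vec hδ.ne' hn ha h0 hs (hφ _) u.2,
      pathModel_pair_vec hδ.ne' hn ha h0 hs w.2 u.2, e5]
  let e := Equiv.ofBijective Φ ⟨hinj, hsurj⟩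
  rw [← Matrix.det_submatrix_equiv_self e] at hdet
  have hmat : (Matrix.of fun w u : {w : List Bool // IsDyck k w} =>
      L.pair k (L.vec k w.1) (L.vec k u.1)).submatrix e e =
      Matrix.of fun π σ => (δ ^ k * r π) *
        (Matrix.of fun π σ => r σ * gramMatrix k (n : ℝ) π σ) π σ := by
    ext π σ
    simp only [Matrix.submatrix_apply, Matrix.of_apply]
    rw [pathModel_pair_vec hδ.ne' hn ha h0 hs (e π).2 (e σ).2]
    rw [show M.vec k (e π).1 = r π • blockVec n π.1 from hv π,
      show M.vec k (e σ).1 = r σ • blockVec n σ.1 from hv σ]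
    change _ * colorPair k (extendZero (r π • blockVec n π.1))
      (extendZero (r σ • blockVec n σ.1)) = _
    rw [gramMatrix, Matrix.of_apply, ← colorPair_blockVec, extendZero_smul, extendZero_smul]
    simp only [colorPair, Finset.mul_sum]
    exact Finset.sum_congr rfl fun x _ => by ring
  rw [hmat, Matrix.det_mul_column, Matrix.det_mul_row, ← mul_assoc,
    ← Finset.prod_mul_distrib] at hdet
  rw [← hdet, ← mul_assoc, gramExponent]
  have hprod : δ ^ (∑ π : NCPartition k, (2 * (blockCount π.1 : ℤ) - (k : ℤ))) *
      ∏ π : NCPartition k, δ ^ k * r π * r π = 1 := by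
    have : δ ^ (∑ π : NCPartition k, (2 * (blockCount π.1 : ℤ) - (k : ℤ))) =
        ∏ π : NCPartition k, δ ^ (2 * (blockCount π.1 : ℤ) - (k : ℤ)) := by
      induction (Finset.univ : Finset (NCPartition k)) using Finset.induction_on with
      | empty => simp
      | insert π s hπ ih =>
        rw [Finset.sum_insert hπ, Finset.prod_insert hπ, zpow_add₀ hδ.ne', ih]
    rw [this, ← Finset.prod_mul_distrib]
    refine Finset.prod_eq_one fun π _ => ?_
    have e2 := sq_mul_pow_blockCount hδ.ne' hn (hφ π) (hv π)
    rw [zpow_sub₀ hδ.ne', zpow_natCast, show (2 * (blockCount π.1 : ℤ)) =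
      ((2 * blockCount π.1 : ℕ) : ℤ) by push_cast; ring, zpow_natCast]
    have hk := pow_ne_zero k hδ.ne'
    calc _ = (δ ^ k / δ ^ k) * (r π ^ 2 * δ ^ (2 * blockCount π.1)) := by ring
      _ = 1 := by rw [e2, div_self hk, one_mul]
  rw [hprod, one_mul]

end Gram

/-! ### The product of the norms of paths -/

/-- The number of paths of length `m` (not necessarily nonnegative) with displacement `p`. -/
def freePaths : ℕ → ℤ → ℤ
  | 0, p => if p = 0 then 1 else 0
  | m + 1, p => freePaths m (p - 1) + freePaths m (p + 1)

theorem intBinom_succ (m : ℕ) (j : ℤ) : intBinom (m + 1) j = intBinom m j + intBinom m (j - 1) := by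
  unfold intBinom
  rcases lt_trichotomy j 0 with h | rfl | h
  · simp [not_le.2 h, show ¬ (1 : ℤ) ≤ j by omega]
  · simp
  · obtain ⟨i, rfl⟩ : ∃ i : ℕ, j = i + 1 := ⟨(j - 1).toNat, by omega⟩
    rw [if_pos (by omega), if_pos (by omega), if_pos (by omega)]
    rw [show ((i : ℤ) + 1).toNat = i + 1 by omega, show ((i : ℤ) + 1 - 1).toNat = i by omega,
      Nat.choose_succ_succ]
    push_cast
    ring

theorem freePaths_eq_intBinom (m : ℕ) (j : ℤ) : freePaths m (m - 2 * j) = intBinom m j := by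
  induction m generalizing j with
  | zero =>
    rw [freePaths, intBinom]
    rcases lt_trichotomy j 0 with h | rfl | h
    · rw [if_neg (by push_cast; omega), if_neg (by omega)]
    · simp
    · obtain ⟨i, hi⟩ : ∃ i : ℕ, j.toNat = i + 1 := ⟨j.toNat - 1, by omega⟩
      rw [if_neg (by push_cast; omega), if_pos (by omega), hi]
      simp
  | succ m ih =>
    rw [freePaths, intBinom_succ, ← ih, ← ih]
    congr 2 <;> push_cast <;> ring

open Classical in
/-- The norm of a path, and `1` for words which are not paths. -/
noncomputable def pathNormOrOne (a : ℕ → ℝ) (h : ℕ) (w : List Bool) : ℝ :=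
  if BallotFrom h w then pathNorm a h w else 1

/-- The number of paths of length `N` from height `h` to height `0`. -/
def ballotCount (N h : ℕ) : ℤ := freePaths N h - freePaths N (h + 2)

theorem freePaths_neg (m : ℕ) (p : ℤ) : freePaths m (-p) = freePaths m p := by
  induction m generalizing p with
  | zero => simp [freePaths]
  | succ m ih =>
    rw [freePaths, freePaths, show -p - 1 = -(p + 1) by ring, show -p + 1 = -(p - 1) by ring,
      ih, ih, add_comm]

/-- The exponent of `a (r - 1)` in the product of the norms of the paths of length `N` from
height `h` to height `0`. -/
def stepCount (N h r : ℕ) : ℤ :=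
  freePaths N (max (2 * r - h : ℤ) h) - freePaths N (2 * r + h + 2)

theorem stepCount_succ_zero (N : ℕ) {r : ℕ} (hr : 1 ≤ r) :
    stepCount (N + 1) 0 r = stepCount N 1 r := by
  simp only [stepCount, freePaths]
  push_cast
  rw [max_eq_left (by omega), max_eq_left (by omega)]
  ring_nf

theorem stepCount_succ_succ (N h r : ℕ) :
    stepCount (N + 1) (h + 1) r = stepCount N (h + 2) r + stepCount N h r +
      if r = h + 1 then ballotCount N h else 0 := by
  simp only [stepCount, freePaths, ballotCount]
  push_cast
  rcases lt_trichotomy r (h + 1) with hr | rfl | hr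
  · rw [max_eq_right (by omega), max_eq_right (by omega), max_eq_right (by omega),
      if_neg (by omega)]
    ring_nf
  · rw [max_eq_right (by omega), max_eq_right (by push_cast; omega),
      max_eq_left (by push_cast; omega), if_pos rfl]
    push_cast
    ring_nf
  · rw [max_eq_left (by omega), max_eq_left (by omega), max_eq_left (by omega),
      if_neg (by omega)]
    ring_nf

theorem ballotCount_succ_zero (N : ℕ) : ballotCount (N + 1) 0 = ballotCount N 1 := by
  simp only [ballotCount, freePaths]
  rw [show ((0 : ℕ) : ℤ) - 1 = -1 by norm_num, freePaths_neg]
  push_cast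
  ring_nf

theorem ballotCount_succ_succ (N h : ℕ) :
    ballotCount (N + 1) (h + 1) = ballotCount N (h + 2) + ballotCount N h := by
  simp only [ballotCount, freePaths]
  push_cast
  ring_nf

open Classical in
/-- The constant `b` on paths, and `1` on words which are not paths. -/
noncomputable def constOrOne (b : ℝ) (h : ℕ) (w : List Bool) : ℝ :=
  if BallotFrom h w then b else 1

theorem prod_constOrOne (N : ℕ) : ∀ h (b : ℝ), b ≠ 0 →
    ∏ x : Fin N → Bool, constOrOne b h (List.ofFn x) = b ^ ballotCount N h := by
  induction N with
  | zero =>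
    intro h b hb
    rw [prod_ofFn_zero (constOrOne b h), constOrOne]
    rcases h with _ | h
    · simp [BallotFrom, ballotCount, freePaths]
    · simp [BallotFrom, ballotCount, freePaths, show ¬ ((h : ℤ) + 1 = 0) by omega,
        show ¬ ((h : ℤ) + 1 + 2 = 0) by omega]
  | succ N ih =>
    intro h b hb
    rw [prod_ofFn_succ N (constOrOne b h), Fintype.prod_bool]
    have e1 : ∀ w, constOrOne b h (true :: w) = constOrOne b (h + 1) w := fun w => rfl
    simp only [e1]
    rcases h with _ | h
    · have e2 : ∀ w, constOrOne b 0 (false :: w) = 1 := fun w => if_neg id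
      simp only [e2, Finset.prod_const_one, mul_one]
      rw [ballotCount_succ_zero]
      exact ih _ b hb
    · have e2 : ∀ w, constOrOne b (h + 1) (false :: w) = constOrOne b h w := fun w => rfl
      simp only [e2]
      rw [ballotCount_succ_succ, zpow_add₀ hb, ← ih _ b hb, ← ih _ b hb]

theorem prod_pathNormOrOne {a : ℕ → ℝ} (ha : ∀ h, a h ≠ 0) (R : ℕ) (N : ℕ) :
    ∀ h, h + N ≤ R → ∏ x : Fin N → Bool, pathNormOrOne a h (List.ofFn x) =
      ∏ r ∈ Finset.Icc 1 R, a (r - 1) ^ stepCount N h r := by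
  classical
  induction N with
  | zero =>
    intro h _
    rw [prod_ofFn_zero (pathNormOrOne a h)]
    have h1 : pathNormOrOne a h [] = 1 := by
      unfold pathNormOrOne BallotFrom pathNorm
      split_ifs <;> rfl
    rw [h1]
    refine (Finset.prod_eq_one fun r hr => ?_).symm
    have hr1 := (Finset.mem_Icc.1 hr).1
    rw [stepCount, freePaths, freePaths, if_neg (by omega), if_neg (by omega)]
    simp
  | succ N ih =>
    intro h hR
    rw [prod_ofFn_succ N (pathNormOrOne a h), Fintype.prod_bool]
    rcases h with _ | h
    · have e1 : ∀ w, pathNormOrOne a 0 (true :: w) = pathNormOrOne a 1 w := fun w => rfl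
      have e2 : ∀ w, pathNormOrOne a 0 (false :: w) = 1 := fun w => if_neg id
      simp only [e1, e2, Finset.prod_const_one, mul_one]
      rw [ih 1 (by omega)]
      exact Finset.prod_congr rfl fun r hr => by
        rw [stepCount_succ_zero N (Finset.mem_Icc.1 hr).1]
    · have e1 : ∀ w, pathNormOrOne a (h + 1) (true :: w) = pathNormOrOne a (h + 2) w :=
        fun w => rfl
      have e2 : ∀ w, pathNormOrOne a (h + 1) (false :: w) =
          constOrOne (a h) h w * pathNormOrOne a h w := by
        intro w
        change (if BallotFrom h w then a h * pathNorm a h w else 1) = _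
        rw [pathNormOrOne, constOrOne]
        split_ifs <;> simp
      simp only [e1, e2, Finset.prod_mul_distrib]
      rw [ih (h + 2) (by omega), ih h (by omega), prod_constOrOne N h _ (ha h)]
      have e3 : a h ^ ballotCount N h = ∏ r ∈ Finset.Icc 1 R,
          a (r - 1) ^ (if r = h + 1 then ballotCount N h else 0) := by
        rw [Finset.prod_eq_single (h + 1)]
        · simp
        · intro r _ hr
          simp [hr]
        · intro hr
          exact absurd (Finset.mem_Icc.2 ⟨by omega, by omega⟩) hr
      rw [e3, ← Finset.prod_mul_distrib, ← Finset.prod_mul_distrib]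
      refine Finset.prod_congr rfl fun r _ => ?_
      rw [stepCount_succ_succ, zpow_add₀ (ha _), zpow_add₀ (ha _)]
      ring

theorem stepCount_two_mul_zero (k r : ℕ) : stepCount (2 * k) 0 r = fCoeff k r := by
  rw [stepCount, fCoeff, ← freePaths_eq_intBinom, ← freePaths_eq_intBinom]
  push_cast
  rw [max_eq_left (by omega)]
  ring_nf

theorem fCoeff_of_lt {k : ℕ} {r : ℤ} (h : (k : ℤ) < r) : fCoeff k r = 0 := by
  rw [fCoeff, intBinom, intBinom, if_neg (by omega), if_neg (by omega), sub_zero]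

/-- The product of the norms of the Dyck paths of length `2 * k`. -/
theorem prod_pathNorm {a : ℕ → ℝ} (ha : ∀ h, a h ≠ 0) (k : ℕ) :
    ∏ w : {w : List Bool // IsDyck k w}, pathNorm a 0 w.1 =
      ∏ r ∈ Finset.Icc 1 k, a (r - 1) ^ fCoeff k r := by
  have h1 : ∏ w : {w : List Bool // IsDyck k w}, pathNorm a 0 w.1 =
      ∏ w : {w : List Bool // IsDyck k w}, pathNormOrOne a 0 w.1 :=
    Finset.prod_congr rfl fun w _ => (if_pos w.2.2).symm
  rw [h1, prod_subtype_eq_prod_ofFn (N := 2 * k) (P := IsDyck k) (fun w hw => hw.1)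
    (pathNormOrOne a 0) (fun w hw hw' => if_neg fun hb => hw' ⟨hw, hb⟩),
    prod_pathNormOrOne ha (2 * k) (2 * k) 0 (by omega)]
  simp only [stepCount_two_mul_zero]
  symm
  refine Finset.prod_subset (Finset.Icc_subset_Icc_right (by omega)) fun r hr hr' => ?_
  rw [Finset.mem_Icc] at hr hr'
  rw [fCoeff_of_lt (by omega), zpow_zero]

/-- Summation by parts for products. -/
theorem prod_div_zpow {P : ℕ → ℝ} (hP : ∀ r, P r ≠ 0) (h0 : P 0 = 1) (f : ℕ → ℤ) (k : ℕ) :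
    ∏ r ∈ Finset.Icc 1 k, (P r / P (r - 1)) ^ f r =
      (∏ r ∈ Finset.Icc 1 k, P r ^ (f r - f (r + 1))) * P k ^ f (k + 1) := by
  induction k with
  | zero => simp [h0]
  | succ k ih =>
    rw [Finset.prod_Icc_succ_top (by omega), ih, Finset.prod_Icc_succ_top (by omega), div_zpow,
      Nat.add_sub_cancel, zpow_sub₀ (hP _)]
    have h1 := zpow_ne_zero (f (k + 1)) (hP k)
    have h2 := zpow_ne_zero (f (k + 1 + 1)) (hP (k + 1))
    field_simp

open Polynomial in
theorem chebyshevS_eval_succ_succ (x : ℝ) (r : ℕ) :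
    (Chebyshev.S ℝ ((r + 2 : ℕ) : ℤ)).eval x =
      x * (Chebyshev.S ℝ ((r + 1 : ℕ) : ℤ)).eval x - (Chebyshev.S ℝ (r : ℤ)).eval x := by
  push_cast
  rw [Chebyshev.S_add_two]
  simp

open Polynomial in
theorem chebyshevS_eval_pos {x : ℝ} (hx : 2 ≤ x) (r : ℕ) :
    0 < (Chebyshev.S ℝ (r : ℤ)).eval x := by
  have key : ∀ r : ℕ, 0 < (Chebyshev.S ℝ (r : ℤ)).eval x ∧
      (Chebyshev.S ℝ (r : ℤ)).eval x ≤ (Chebyshev.S ℝ ((r + 1 : ℕ) : ℤ)).eval x := by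
    intro r
    induction r with
    | zero =>
      simp
      linarith
    | succ r ih =>
      refine ⟨ih.1.trans_le ih.2, ?_⟩
      rw [chebyshevS_eval_succ_succ]
      nlinarith [ih.1, ih.2]
  exact (key r).1

open Polynomial in
theorem chebyshevS_eval_zero_of_odd {r : ℕ} (hr : Odd r) :
    (Chebyshev.S ℝ (r : ℤ)).eval 0 = 0 := by
  obtain ⟨m, rfl⟩ := hr
  induction m with
  | zero => simp
  | succ m ih =>
    rw [show 2 * (m + 1) + 1 = (2 * m + 1) + 2 by ring, chebyshevS_eval_succ_succ, ih]
    simp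

open Polynomial in
/-- The determinant formula at natural numbers. -/
theorem det_gramMatrix_of_four_le (k : ℕ) {n : ℕ} (hn : 4 ≤ n) :
    (gramMatrix k (n : ℝ)).det = (Real.sqrt n) ^ gramExponent k *
      ∏ r ∈ Finset.Icc 1 k, ((Chebyshev.S ℝ (r : ℤ)).eval (Real.sqrt n)) ^ dExponent k r := by
  have h4 : (4 : ℝ) ≤ n := by exact_mod_cast hn
  have h2 : 2 ≤ Real.sqrt n := Real.le_sqrt_of_sq_le (by norm_num; exact hn)
  have hsq : Real.sqrt n ^ 2 = n := Real.sq_sqrt (by linarith)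
  set x := Real.sqrt n
  let P : ℕ → ℝ := fun r => (Chebyshev.S ℝ (r : ℤ)).eval x
  have hP : ∀ r, P r ≠ 0 := fun r => (chebyshevS_eval_pos h2 r).ne'
  have hP0 : P 0 = 1 := by simp [P]
  have ha : ∀ h, P (h + 1) / P h ≠ 0 := fun h => div_ne_zero (hP _) (hP _)
  rw [det_gramMatrix_natCast (a := fun h => P (h + 1) / P h) (by omega) (by linarith) hsq ha
    (by simp [P]) (fun h => ?_) k, prod_pathNorm ha]
  · congr 1
    have h1 := prod_div_zpow hP hP0 (fun r => fCoeff k r) k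
    rw [fCoeff_of_lt (by push_cast; omega), zpow_zero, mul_one] at h1
    calc _ = ∏ r ∈ Finset.Icc 1 k, (P r / P (r - 1)) ^ fCoeff k r :=
          Finset.prod_congr rfl fun r hr => by
            rw [Nat.sub_add_cancel (Finset.mem_Icc.1 hr).1]
      _ = _ := h1
      _ = _ := by simp [P, dExponent]
  · have h1 : P (h + 2) = x * P (h + 1) - P h := chebyshevS_eval_succ_succ x h
    have h2 := hP (h + 1)
    change P (h + 2) / P (h + 1) + (P (h + 1) / P h)⁻¹ = x
    rw [h1]
    field_simp
    ring

theorem zpow_mul_pow_toNat {K : Type*} [Field K] {z : K} {e : ℤ} (h : e < 0 → z ≠ 0) :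
    z ^ e * z ^ (-e).toNat = z ^ e.toNat := by
  rcases lt_or_ge e 0 with he | he
  · obtain ⟨m, rfl⟩ : ∃ m : ℕ, e = -m := ⟨(-e).toNat, by omega⟩
    have := pow_ne_zero m (h he)
    simp [this]
  · obtain ⟨m, rfl⟩ : ∃ m : ℕ, e = m := ⟨e.toNat, by omega⟩
    simp

theorem map_det_gramMatrix {R S : Type*} [CommRing R] [CommRing S] (φ : R →+* S) (k : ℕ) (n : R) :
    φ (gramMatrix k n).det = (gramMatrix k (φ n)).det := by
  rw [RingHom.map_det]
  congr 1
  ext π σ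
  simp [gramMatrix]

section Polynomial

open Polynomial

/-- The numerator of the right side of the determinant formula. -/
noncomputable def gramNum (k : ℕ) : ℚ[X] :=
  X ^ (gramExponent k).toNat *
    ∏ r ∈ Finset.Icc 1 k, Chebyshev.S ℚ (r : ℤ) ^ (dExponent k r).toNat

/-- The denominator of the right side of the determinant formula. -/
noncomputable def gramDen (k : ℕ) : ℚ[X] :=
  X ^ (-gramExponent k).toNat *
    ∏ r ∈ Finset.Icc 1 k, Chebyshev.S ℚ (r : ℤ) ^ (-dExponent k r).toNat

theorem mul_map_gramDen {K : Type*} [Field K] (φ : ℚ[X] →+* K) (k : ℕ) (hX : φ X ≠ 0)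
    (hS : ∀ r ∈ Finset.Icc 1 k, dExponent k r < 0 → φ (Chebyshev.S ℚ (r : ℤ)) ≠ 0) :
    (φ X ^ gramExponent k * ∏ r ∈ Finset.Icc 1 k, φ (Chebyshev.S ℚ (r : ℤ)) ^ dExponent k r) *
      φ (gramDen k) = φ (gramNum k) := by
  simp only [gramDen, gramNum, map_mul, map_pow, map_prod]
  rw [mul_mul_mul_comm, ← Finset.prod_mul_distrib, zpow_mul_pow_toNat fun _ => hX]
  congr 1
  exact Finset.prod_congr rfl fun r hr => zpow_mul_pow_toNat (hS r hr)

theorem map_gramDen_ne_zero {K : Type*} [Field K] (φ : ℚ[X] →+* K) (k : ℕ) (hX : φ X ≠ 0)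
    (hS : ∀ r ∈ Finset.Icc 1 k, dExponent k r < 0 → φ (Chebyshev.S ℚ (r : ℤ)) ≠ 0) :
    φ (gramDen k) ≠ 0 := by
  simp only [gramDen, map_mul, map_pow, map_prod]
  refine mul_ne_zero (pow_ne_zero _ hX) (Finset.prod_ne_zero_iff.2 fun r hr => ?_)
  rcases lt_or_ge (dExponent k r) 0 with h | h
  · exact pow_ne_zero _ (hS r hr h)
  · simp [show (-dExponent k r).toNat = 0 by omega]

theorem eval₂_chebyshevS (x : ℝ) (r : ℤ) :
    eval₂RingHom (algebraMap ℚ ℝ) x (Chebyshev.S ℚ r) = (Chebyshev.S ℝ r).eval x := by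
  rw [coe_eval₂RingHom, eval₂_eq_eval_map, Chebyshev.map_S]

theorem det_gramMatrix_mul_gramDen (k : ℕ) :
    (gramMatrix k ((X : ℚ[X]) ^ 2)).det * gramDen k = gramNum k := by
  apply map_injective (algebraMap ℚ ℝ) (algebraMap ℚ ℝ).injective
  refine eq_of_infinite_eval_eq _ _ (Set.infinite_of_injective_forall_mem
    (f := fun m : ℕ => Real.sqrt ((m + 4 : ℕ) : ℝ)) ?_ fun m => ?_)
  · intro m m' h
    have := (Real.sqrt_inj (Nat.cast_nonneg _) (Nat.cast_nonneg _)).1 h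
    simpa using this
  · set x := Real.sqrt ((m + 4 : ℕ) : ℝ) with hx
    have h4 : (4 : ℝ) ≤ ((m + 4 : ℕ) : ℝ) := by exact_mod_cast (by omega : 4 ≤ m + 4)
    have h2 : 2 ≤ x := Real.le_sqrt_of_sq_le (by norm_num at h4 ⊢)
    have hsq : x ^ 2 = ((m + 4 : ℕ) : ℝ) := Real.sq_sqrt (by linarith)
    rw [Set.mem_ofPred_eq, eval_map, eval_map, ← coe_eval₂RingHom]
    set φ := eval₂RingHom (algebraMap ℚ ℝ) x with hφ
    have hφX : φ X = x := by simp [hφ]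
    rw [map_mul, map_det_gramMatrix, map_pow, hφX, hsq,
      det_gramMatrix_of_four_le k (by omega), ← hx,
      ← mul_map_gramDen φ k (by rw [hφX]; linarith) fun r _ _ => by
        rw [hφ, eval₂_chebyshevS]; exact (chebyshevS_eval_pos h2 r).ne']
    rw [hφX]
    simp only [hφ, eval₂_chebyshevS]

theorem det_gramMatrix_map {K : Type*} [Field K] (φ : ℚ[X] →+* K) (k : ℕ) (hX : φ X ≠ 0)
    (hS : ∀ r ∈ Finset.Icc 1 k, dExponent k r < 0 → φ (Chebyshev.S ℚ (r : ℤ)) ≠ 0) :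
    (gramMatrix k (φ X ^ 2)).det = φ X ^ gramExponent k *
      ∏ r ∈ Finset.Icc 1 k, φ (Chebyshev.S ℚ (r : ℤ)) ^ dExponent k r := by
  apply mul_right_cancel₀ (map_gramDen_ne_zero φ k hX hS)
  rw [mul_map_gramDen φ k hX hS, ← det_gramMatrix_mul_gramDen, map_mul, map_det_gramMatrix,
    map_pow]

theorem chebyshevS_rat_ne_zero (r : ℕ) : Chebyshev.S ℚ (r : ℤ) ≠ 0 := by
  intro h
  have h1 := chebyshevS_eval_pos le_rfl r
  rw [← eval₂_chebyshevS, h, map_zero] at h1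
  exact h1.false

theorem fCoeff_self (k : ℕ) : fCoeff k k = 1 := by
  simp [fCoeff, intBinom]

theorem dExponent_self (k : ℕ) : dExponent k k = 1 := by
  rw [dExponent, fCoeff_self, fCoeff_of_lt (by omega), sub_zero]

theorem dExponent_pred (k : ℕ) : dExponent (k + 1) k = 2 * k := by
  have h1 : fCoeff (k + 1) (k + 1 : ℤ) = 1 := by exact_mod_cast fCoeff_self (k + 1)
  rw [dExponent, h1, fCoeff]
  push_cast
  rw [show (k : ℤ) + 1 - k = 1 by ring]
  simp [intBinom]
  ring

theorem det_gramMatrix_zero (k : ℕ) : (gramMatrix (k + 1) (0 : ℝ)).det = 0 := by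
  have h : IsNoncrossing (⊤ : Setoid (Fin (k + 1))) := fun _ _ _ _ _ _ _ _ _ => trivial
  refine Matrix.det_eq_zero_of_row_eq_zero ⟨⊤, h⟩ fun σ => ?_
  rw [gramMatrix, Matrix.of_apply, blockCount]
  exact zero_pow Nat.card_pos.ne'

theorem prod_chebyshevS_eval_zero (k : ℕ) :
    ∏ r ∈ Finset.Icc 1 (k + 1), ((Chebyshev.S ℝ (r : ℤ)).eval 0) ^ dExponent (k + 1) r = 0 := by
  rcases Nat.even_or_odd (k + 1) with h | h
  · have hk : Odd k := by
      rcases Nat.even_or_odd k with h' | h'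
      · exact absurd h (by rw [Nat.even_add_one]; simpa using h')
      · exact h'
    refine Finset.prod_eq_zero (i := k) (Finset.mem_Icc.2 ⟨hk.pos, by omega⟩) ?_
    rw [chebyshevS_eval_zero_of_odd hk, dExponent_pred]
    exact zero_zpow _ (by have := hk.pos; omega)
  · refine Finset.prod_eq_zero (i := k + 1) (Finset.mem_Icc.2 ⟨by omega, le_rfl⟩) ?_
    rw [chebyshevS_eval_zero_of_odd h, dExponent_self]
    simp

end Polynomial

theorem theorem5p3 (k : ℕ) :
    ((gramMatrix k ((RatFunc.X : RatFunc ℚ) ^ 2)).det =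
      (RatFunc.X : RatFunc ℚ) ^ gramExponent k *
        ∏ r ∈ Finset.Icc 1 k,
          (algebraMap (Polynomial ℚ) (RatFunc ℚ) (Polynomial.Chebyshev.S ℚ (r : ℤ))) ^
            dExponent k (r : ℤ)) ∧
    ∀ n : ℝ, 0 ≤ n →
      (∀ r ∈ Finset.Icc 1 k, dExponent k (r : ℤ) < 0 →
        (Polynomial.Chebyshev.S ℝ (r : ℤ)).eval (Real.sqrt n) ≠ 0) →
      (gramMatrix k n).det =
        (Real.sqrt n) ^ gramExponent k *
          ∏ r ∈ Finset.Icc 1 k,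
            ((Polynomial.Chebyshev.S ℝ (r : ℤ)).eval (Real.sqrt n)) ^ dExponent k (r : ℤ) := by
  constructor
  · have hinj := RatFunc.algebraMap_injective ℚ
    have h := det_gramMatrix_map (algebraMap (Polynomial ℚ) (RatFunc ℚ)) k
      (by rw [RatFunc.algebraMap_X]; exact RatFunc.X_ne_zero)
      fun r _ _ => (map_ne_zero_iff _ hinj).2 (chebyshevS_rat_ne_zero r)
    rwa [RatFunc.algebraMap_X] at h
  · intro n hn hS
    rcases hn.eq_or_lt with rfl | hpos
    · rcases k with _ | k
      · have h := det_gramMatrix_of_four_le 0 (le_refl 4)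
        have h0 : gramExponent 0 = 0 := by
          simp [gramExponent, blockCount]
        have hdet : (gramMatrix 0 (0 : ℝ)).det = (gramMatrix 0 ((4 : ℕ) : ℝ)).det := by
          congr 1
          ext π σ
          simp [gramMatrix, blockCount]
        rw [hdet, h, h0]
        simp
      · rw [det_gramMatrix_zero, Real.sqrt_zero, prod_chebyshevS_eval_zero, mul_zero]
    · have hX : Polynomial.eval₂RingHom (algebraMap ℚ ℝ) (Real.sqrt n) Polynomial.X =
          Real.sqrt n := by simp
      have h := det_gramMatrix_map (Polynomial.eval₂RingHom (algebraMap ℚ ℝ) (Real.sqrt n)) k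
        (by rw [hX]; exact (Real.sqrt_pos.2 hpos).ne')
        fun r hr hd => by rw [eval₂_chebyshevS]; exact hS r hr hd
      rw [hX, Real.sq_sqrt hn] at h
      simpa only [eval₂_chebyshevS] using h
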